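/- Let $n\ge 0$ be an integer. There exist constants $C>0$ and $m\in\mathbb N$, depending only on $n$, such that the following holds for every bounded open set $\Omega\subset\mathbb R^{n+1}$. Let $$Lu=\sum_{i,j}a_{ij}D_iD_ju+\sum_i b^iD_iu+cu$$ have measurable coefficients on $\Omega$ with, for constants $\lambda,\Lambda,c_1,c_2>0$ and almost everywhere in $\Omega$, $$\lambda|\xi|^2\le \sum_{i,j}a_{ij}\xi_i\xi_j\le\Lambda|\xi|^2\ \text{ for all }\xi\in\mathbb R^{n+1},\qquad |b^i|\le c_1\ \text{ for all } i,\qquad |c|\le c_2,\qquad c\le 0 .$$ Let $f\in L^{n+1}(\Omega)$ and let $u\in C^0(\bar\Omega)\cap W^{2,n+1}_{\mathrm{loc}}(\Omega)$ vanish on $\partial\Omega$ and satisfy $Lu\ge f$ almost everywhere in $\Omega$. Then $$\sup_\Omega u\le e^{P}\,(\operatorname{diam}\Omega)\,\|f\|_{L^{n+1}(\Omega)},\qquad P=C\,(1+|\Omega|)\,\Bigl(\max\bigl\{\lambda,\tfrac1\lambda,\Lambda,\tfrac1\Lambda,c_1,\tfrac1{c_1},c_2,\tfrac1{c_2}\bigr\}\Bigr)^{m},$$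 where $|\Omega|$ is the Lebesgue measure of $\Omega$. In particular, on a fixed $\Omega$ (or for all $\Omega$ of measure at most a given constant) the constant is $e^{P}$ with $P=P(\lambda,\Lambda,c_1,c_2)$ depending at most polynomially on $\lambda^{\pm1},\Lambda^{\pm1},c_1^{\pm1},c_2^{\pm1}$. -/

import Mathlib

open MeasureTheory
open scoped ENNReal ContDiff

noncomputable section

namespace ABP

/-- Local `L^p` membership: `g ∈ L^p(K)` for every compact `K ⊆ Ω`. -/
def MemLpLoc {N : ℕ} (p : ℝ≥0∞) (Ω : Set (EuclideanSpace ℝ (Fin N)))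
    (g : EuclideanSpace ℝ (Fin N) → ℝ) : Prop :=
  ∀ K : Set (EuclideanSpace ℝ (Fin N)), IsCompact K → K ⊆ Ω →
    MemLp g p (volume.restrict K)

/-- `v` is the weak partial derivative `D_i u` on the open set `Ω`. -/
structure HasWeakPartial {N : ℕ} (Ω : Set (EuclideanSpace ℝ (Fin N))) (i : Fin N)
    (u v : EuclideanSpace ℝ (Fin N) → ℝ) : Prop where
  locallyIntegrable : LocallyIntegrableOn u Ω volume
  locallyIntegrable_deriv : LocallyIntegrableOn v Ω volume
  integral_eq : ∀ φ : EuclideanSpace ℝ (Fin N) → ℝ,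
    ContDiff ℝ ∞ φ → HasCompactSupport φ → tsupport φ ⊆ Ω →
      ∫ x in Ω, u x * fderiv ℝ φ x (EuclideanSpace.single i 1) = - ∫ x in Ω, v x * φ x

/-- `u ∈ W^{2,p}_loc(Ω)`, with weak gradient `Du` and weak Hessian `D2u`
(`D2u i j` is the weak partial derivative of `Du j` in direction `i`). -/
structure IsW2Loc {N : ℕ} (p : ℝ≥0∞) (Ω : Set (EuclideanSpace ℝ (Fin N)))
    (u : EuclideanSpace ℝ (Fin N) → ℝ)
    (Du : Fin N → EuclideanSpace ℝ (Fin N) → ℝ)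
    (D2u : Fin N → Fin N → EuclideanSpace ℝ (Fin N) → ℝ) : Prop where
  memLp : MemLpLoc p Ω u
  memLp_grad : ∀ i, MemLpLoc p Ω (Du i)
  memLp_hess : ∀ i j, MemLpLoc p Ω (D2u i j)
  weak_grad : ∀ i, HasWeakPartial Ω i u (Du i)
  weak_hess : ∀ i j, HasWeakPartial Ω i (Du j) (D2u i j)

/-- `u ∈ C⁰₀(Ω̄)`: continuous on the closure and zero on the boundary. -/
structure IsC00 {N : ℕ} (Ω : Set (EuclideanSpace ℝ (Fin N)))
    (u : EuclideanSpace ℝ (Fin N) → ℝ) : Prop where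
  continuousOn : ContinuousOn u (closure Ω)
  eq_zero : ∀ x ∈ frontier Ω, u x = 0

/-- The assumptions on the coefficients of `L = a_ij D_i D_j + b^i D_i + c` on `Ω`:
measurability and `lam ≤ a ≤ Lam` (as quadratic forms), `|b^i| ≤ c₁`, `|c| ≤ c₂`, `c ≤ 0`. -/
structure CoeffBounds {N : ℕ} (Ω : Set (EuclideanSpace ℝ (Fin N)))
    (a : Fin N → Fin N → EuclideanSpace ℝ (Fin N) → ℝ)
    (b : Fin N → EuclideanSpace ℝ (Fin N) → ℝ)
    (c : EuclideanSpace ℝ (Fin N) → ℝ) (lam Lam c₁ c₂ : ℝ) : Prop where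
  measurable_a : ∀ i j, AEMeasurable (a i j) (volume.restrict Ω)
  measurable_b : ∀ i, AEMeasurable (b i) (volume.restrict Ω)
  measurable_c : AEMeasurable c (volume.restrict Ω)
  lower : ∀ᵐ x ∂(volume.restrict Ω), ∀ ξ : EuclideanSpace ℝ (Fin N),
    lam * ‖ξ‖ ^ 2 ≤ ∑ i, ∑ j, a i j x * ξ i * ξ j
  upper : ∀ᵐ x ∂(volume.restrict Ω), ∀ ξ : EuclideanSpace ℝ (Fin N),
    ∑ i, ∑ j, a i j x * ξ i * ξ j ≤ Lam * ‖ξ‖ ^ 2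
  bound_b : ∀ᵐ x ∂(volume.restrict Ω), ∀ i, |b i x| ≤ c₁
  bound_c : ∀ᵐ x ∂(volume.restrict Ω), |c x| ≤ c₂
  nonpos_c : ∀ᵐ x ∂(volume.restrict Ω), c x ≤ 0

/-- `Lu = a_ij D_i D_j u + b^i D_i u + c u`, for `u` with derivatives `Du` and `D2u`. -/
def ellipticOp {N : ℕ}
    (a : Fin N → Fin N → EuclideanSpace ℝ (Fin N) → ℝ)
    (b : Fin N → EuclideanSpace ℝ (Fin N) → ℝ)
    (c : EuclideanSpace ℝ (Fin N) → ℝ)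
    (u : EuclideanSpace ℝ (Fin N) → ℝ)
    (Du : Fin N → EuclideanSpace ℝ (Fin N) → ℝ)
    (D2u : Fin N → Fin N → EuclideanSpace ℝ (Fin N) → ℝ)
    (x : EuclideanSpace ℝ (Fin N)) : ℝ :=
  (∑ i, ∑ j, a i j x * D2u i j x) + (∑ i, b i x * Du i x) + c x * u x

/-- The largest of the numbers `l, 1 / l` for `l ∈ {lam, Lam, c₁, c₂}`. -/
def coeffSize (lam Lam c₁ c₂ : ℝ) : ℝ :=
  max (max (max lam lam⁻¹) (max Lam Lam⁻¹)) (max (max c₁ c₁⁻¹) (max c₂ c₂⁻¹))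

end ABP

end

/-!
For a `C²` function `w` exceeding its boundary values by `t` at some point, every plane of slope
`|p| < t / diam` slides down until it touches the graph of `w` from above, so the gradient maps the
upper contact set onto the ball of these slopes. There `-D²w` is positive semidefinite, so its
determinant is at most the `N`-th power of its trace, which ellipticity bounds through `Lw ≥ f`.
By the area formula with weight `(κ ^ N + |p| ^ N)⁻¹`, the logarithm of `t / (κ diam)` is bounded
in terms of `κ⁻¹ ‖f‖` and the drift; letting `κ` decrease to `‖f‖` gives the exponential factor.

A function in `W^{2,N}_loc` is mollified on compact subsets, where the errors in the equation tend
to zero in `L^N` and enter the estimate only through an `L^N` norm.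
-/

namespace ABP

section LinearAlgebra

variable {ι : Type*} [Fintype ι]

theorem mul_trace_le_sum_mul {a : ι → ι → ℝ} {lam : ℝ}
    (ha : ∀ ξ : EuclideanSpace ℝ ι, lam * ‖ξ‖ ^ 2 ≤ ∑ i, ∑ j, a i j * ξ i * ξ j)
    {B : Matrix ι ι ℝ} (hB : B.PosSemidef) :
    lam * B.trace ≤ ∑ i, ∑ j, a i j * B i j := by
  obtain ⟨m, v, rfl⟩ := Matrix.posSemidef_iff_eq_sum_vecMulVec.mp hB
  have rank_one (k : Fin m) :
      lam * ∑ i, v k i * v k i ≤ ∑ i, ∑ j, a i j * (v k i * v k j) := by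
    have h := ha (WithLp.toLp 2 (v k))
    rw [EuclideanSpace.norm_sq_eq] at h
    simpa [pow_two, mul_assoc] using h
  calc lam * (∑ k, Matrix.vecMulVec (v k) (star (v k))).trace
      = ∑ k, lam * ∑ i, v k i * v k i := by
        simp [Matrix.trace, Matrix.sum_apply, Matrix.vecMulVec_apply, Finset.mul_sum,
          Finset.sum_comm (s := (Finset.univ : Finset ι))]
    _ ≤ ∑ k, ∑ i, ∑ j, a i j * (v k i * v k j) := Finset.sum_le_sum fun k _ => rank_one k
    _ = ∑ i, ∑ k, ∑ j, a i j * (v k i * v k j) := Finset.sum_comm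
    _ = _ := Finset.sum_congr rfl fun i _ => by
        rw [Finset.sum_comm]
        simp [Matrix.sum_apply, Matrix.vecMulVec_apply, Finset.mul_sum]

theorem abs_add_swap_le {a : ι → ι → ℝ} {Lam : ℝ}
    (ha : ∀ ξ : EuclideanSpace ℝ ι, 0 ≤ ∑ i, ∑ j, a i j * ξ i * ξ j)
    (ha' : ∀ ξ : EuclideanSpace ℝ ι, ∑ i, ∑ j, a i j * ξ i * ξ j ≤ Lam * ‖ξ‖ ^ 2) (i j : ι) :
    |a i j + a j i| ≤ 2 * Lam := by
  classical
  let e (k : ι) : EuclideanSpace ℝ ι := EuclideanSpace.single k 1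
  let q (ξ : EuclideanSpace ℝ ι) : ℝ := ∑ k, ∑ l, a k l * ξ k * ξ l
  have polarization : q (e i + e j) - q (e i - e j) = 2 * (a i j + a j i) := by
    simp only [q, e, PiLp.add_apply, PiLp.sub_apply, PiLp.single_apply, mul_add, mul_sub,
      Finset.sum_add_distrib, Finset.sum_sub_distrib, mul_ite, mul_one, mul_zero,
      Finset.sum_ite_eq', Finset.mem_univ, if_true]
    ring
  have parallelogram : ‖e i + e j‖ ^ 2 + ‖e i - e j‖ ^ 2 = 4 := by
    have h := parallelogram_law_with_norm ℝ (e i) (e j)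
    simp only [e, PiLp.norm_single, norm_one] at h
    linarith
  have hbound : |q (e i + e j) - q (e i - e j)| ≤ Lam * 4 := by
    rw [← parallelogram, mul_add, abs_le]
    constructor <;> linarith [ha (e i + e j), ha (e i - e j), ha' (e i + e j), ha' (e i - e j)]
  rw [polarization, abs_mul, abs_two] at hbound
  linarith

theorem abs_sum_mul_le_of_symm {a S : ι → ι → ℝ} {Lam : ℝ}
    (ha : ∀ ξ : EuclideanSpace ℝ ι, 0 ≤ ∑ i, ∑ j, a i j * ξ i * ξ j)
    (ha' : ∀ ξ : EuclideanSpace ℝ ι, ∑ i, ∑ j, a i j * ξ i * ξ j ≤ Lam * ‖ξ‖ ^ 2)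
    (hS : ∀ i j, S i j = S j i) :
    |∑ i, ∑ j, a i j * S i j| ≤ Lam * ∑ i, ∑ j, |S i j| := by
  have hswap : ∑ i, ∑ j, a j i * S i j = ∑ i, ∑ j, a i j * S i j := by
    rw [Finset.sum_comm]
    exact Finset.sum_congr rfl fun i _ => Finset.sum_congr rfl fun j _ => by rw [hS]
  have hsymm : ∑ i, ∑ j, (a i j + a j i) * S i j = 2 * ∑ i, ∑ j, a i j * S i j := by
    simp only [add_mul, Finset.sum_add_distrib]
    rw [hswap, two_mul]
  have hbound : |∑ i, ∑ j, (a i j + a j i) * S i j| ≤ ∑ i, ∑ j, 2 * Lam * |S i j| := by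
    refine (Finset.abs_sum_le_sum_abs _ _).trans (Finset.sum_le_sum fun i _ => ?_)
    refine (Finset.abs_sum_le_sum_abs _ _).trans (Finset.sum_le_sum fun j _ => ?_)
    rw [abs_mul]
    exact mul_le_mul_of_nonneg_right (abs_add_swap_le ha ha' i j) (abs_nonneg _)
  simp only [← Finset.mul_sum] at hbound
  rw [hsymm, abs_mul, abs_two] at hbound
  linarith

variable [DecidableEq ι]

theorem det_le_trace_pow_card {B : Matrix ι ι ℝ} (hB : B.PosSemidef) :
    B.det ≤ B.trace ^ Fintype.card ι := by
  have hdet := hB.isHermitian.det_eq_prod_eigenvalues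
  have htrace := hB.isHermitian.trace_eq_sum_eigenvalues
  simp only [RCLike.ofReal_real_eq_id, id] at hdet htrace
  calc B.det = ∏ i, hB.isHermitian.eigenvalues i := hdet
    _ ≤ ∏ _i : ι, ∑ j, hB.isHermitian.eigenvalues j :=
        Finset.prod_le_prod (fun i _ => hB.eigenvalues_nonneg i) fun i _ =>
          Finset.single_le_sum (fun j _ => hB.eigenvalues_nonneg j) (Finset.mem_univ i)
    _ = B.trace ^ Fintype.card ι := by rw [Finset.prod_const, Finset.card_univ, htrace]

theorem abs_det_le_of_posSemidef_neg {a : ι → ι → ℝ} {lam κ : ℝ} (hlam : 0 < lam)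
    (ha : ∀ ξ : EuclideanSpace ℝ ι, lam * ‖ξ‖ ^ 2 ≤ ∑ i, ∑ j, a i j * ξ i * ξ j)
    {H : Matrix ι ι ℝ} (hH : (-H).PosSemidef) (hκ : -∑ i, ∑ j, a i j * H i j ≤ κ) :
    |H.det| ≤ (lam⁻¹ * κ) ^ Fintype.card ι := by
  have htrace : lam * (-H).trace ≤ κ := by
    refine (mul_trace_le_sum_mul ha hH).trans (le_of_eq_of_le ?_ hκ)
    simp
  calc |H.det| = (-H).det := by
        rw [← abs_of_nonneg hH.det_nonneg, Matrix.det_neg, abs_mul, abs_pow, abs_neg, abs_one,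
          one_pow, one_mul]
    _ ≤ (-H).trace ^ Fintype.card ι := det_le_trace_pow_card hH
    _ ≤ (lam⁻¹ * κ) ^ Fintype.card ι :=
        pow_le_pow_left₀ hH.trace_nonneg ((le_inv_mul_iff₀ hlam).mpr htrace) _

end LinearAlgebra

section Hessian

open scoped Gradient RealInnerProductSpace
open InnerProductSpace (toDual)

theorem contDiff_gradient {E : Type*} [NormedAddCommGroup E] [InnerProductSpace ℝ E]
    [CompleteSpace E] {w : E → ℝ} {n m : WithTop ℕ∞} (hw : ContDiff ℝ n w) (hmn : m + 1 ≤ n) :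
    ContDiff ℝ m (∇ w) :=
  (toDual ℝ E).symm.toContinuousLinearEquiv.contDiff.comp (hw.fderiv_right hmn)

theorem inner_fderiv_gradient {E : Type*} [NormedAddCommGroup E] [InnerProductSpace ℝ E]
    [CompleteSpace E] {w : E → ℝ} {x : E} (hw : DifferentiableAt ℝ (fderiv ℝ w) x) (v e : E) :
    ⟪fderiv ℝ (∇ w) x v, e⟫ = fderiv ℝ (fderiv ℝ w) x v e := by
  have h : HasFDerivAt (∇ w)
      ((toDual ℝ E).symm.toContinuousLinearEquiv.toContinuousLinearMap ∘L
        fderiv ℝ (fderiv ℝ w) x) x :=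
    (toDual ℝ E).symm.toContinuousLinearEquiv.toContinuousLinearMap.hasFDerivAt.comp x
      hw.hasFDerivAt
  rw [h.fderiv]
  exact InnerProductSpace.toDual_symm_apply

variable {ι : Type*} [Fintype ι] [DecidableEq ι] {w : EuclideanSpace ℝ ι → ℝ}

/-- The Hessian matrix of `w` at `x`: the second derivative in the standard coordinates. -/
noncomputable def hessian (w : EuclideanSpace ℝ ι → ℝ) (x : EuclideanSpace ℝ ι) : Matrix ι ι ℝ :=
  Matrix.of fun i j =>
    fderiv ℝ (fderiv ℝ w) x (EuclideanSpace.single i 1) (EuclideanSpace.single j 1)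

theorem gradient_apply (w : EuclideanSpace ℝ ι → ℝ) (x : EuclideanSpace ℝ ι) (i : ι) :
    ∇ w x i = fderiv ℝ w x (EuclideanSpace.single i 1) := by
  rw [← inner_gradient_left, EuclideanSpace.inner_single_right]
  simp

theorem continuous_hessian (hw : ContDiff ℝ 2 w) : Continuous (hessian w) := by
  have h : Continuous (fderiv ℝ (fderiv ℝ w)) :=
    (hw.fderiv_right (m := 1) (by norm_num)).continuous_fderiv (by norm_num)
  exact continuous_matrix fun i j => (h.clm_apply continuous_const).clm_apply continuous_const

theorem isSymm_hessian (hw : ContDiff ℝ 2 w) (x : EuclideanSpace ℝ ι) : (hessian w x).IsSymm :=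
  Matrix.IsSymm.ext fun _ _ => hw.contDiffAt.isSymmSndFDerivAt (by simp) _ _

theorem sum_hessian_mul (w : EuclideanSpace ℝ ι → ℝ) (x ξ : EuclideanSpace ℝ ι) :
    ∑ i, ∑ j, hessian w x i j * ξ i * ξ j = fderiv ℝ (fderiv ℝ w) x ξ ξ := by
  have hξ : ∑ i, ξ i • EuclideanSpace.single i (1 : ℝ) = ξ := by
    ext k
    simp [Pi.single_apply]
  conv_rhs => rw [← hξ]
  simp only [map_sum, map_smul, _root_.sum_apply, _root_.smul_apply, smul_eq_mul,
    Finset.mul_sum, hessian, Matrix.of_apply]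
  rw [Finset.sum_comm]
  exact Finset.sum_congr rfl fun i _ => Finset.sum_congr rfl fun j _ => by ring

theorem det_fderiv_gradient (hw : ContDiff ℝ 2 w) (x : EuclideanSpace ℝ ι) :
    (fderiv ℝ (∇ w) x).det = (hessian w x).det := by
  have hd : DifferentiableAt ℝ (fderiv ℝ w) x :=
    (hw.fderiv_right (m := 1) (by norm_num)).differentiable (by norm_num) x
  rw [ContinuousLinearMap.det,
    ← LinearMap.det_toMatrix (EuclideanSpace.basisFun ι ℝ).toBasis, ← Matrix.det_transpose]
  congr 1
  ext i j
  rw [hessian, Matrix.of_apply, ← inner_fderiv_gradient hd, EuclideanSpace.inner_single_right]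
  simp [LinearMap.toMatrix_apply]

theorem posSemidef_neg_hessian (hw : ContDiff ℝ 2 w) {x : EuclideanSpace ℝ ι}
    (h : ∀ ξ, fderiv ℝ (fderiv ℝ w) x ξ ξ ≤ 0) : (-hessian w x).PosSemidef := by
  refine Matrix.PosSemidef.of_dotProduct_mulVec_nonneg ?_ fun ξ => ?_
  · ext i j
    simp [(isSymm_hessian hw x).apply i j]
  · have hquad : star ξ ⬝ᵥ (-hessian w x).mulVec ξ
        = -∑ i, ∑ j, hessian w x i j * WithLp.toLp 2 ξ i * WithLp.toLp 2 ξ j := by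
      simp only [dotProduct, Matrix.mulVec, Finset.mul_sum, ← Finset.sum_neg_distrib]
      refine Finset.sum_congr rfl fun i _ => Finset.sum_congr rfl fun j _ => ?_
      simp
      ring
    rw [hquad, sum_hessian_mul]
    simpa using h (WithLp.toLp 2 ξ)

end Hessian

section ContactSet

open scoped Gradient RealInnerProductSpace

theorem deriv_deriv_nonpos_of_isLocalMax {φ : ℝ → ℝ} {t : ℝ} (h : IsLocalMax φ t)
    (hφ : ContinuousAt φ t) : deriv (deriv φ) t ≤ 0 := by
  by_contra! hpos
  have hmin : IsLocalMin φ t := isLocalMin_of_deriv_deriv_pos hpos h.deriv_eq_zero hφ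
  have hconst : φ =ᶠ[nhds t] fun _ => φ t := by
    filter_upwards [h, hmin] with s hmax hmin using le_antisymm hmax hmin
  exact hpos.ne' (by simp [hconst.deriv.deriv_eq])

theorem fderiv_fderiv_nonpos_of_isLocalMax {E : Type*} [NormedAddCommGroup E] [NormedSpace ℝ E]
    {w : E → ℝ} (hw : ContDiff ℝ 2 w) {y : E} (hy : IsLocalMax w y) (ξ : E) :
    fderiv ℝ (fderiv ℝ w) y ξ ξ ≤ 0 := by
  set γ : ℝ → E := fun t => y + t • ξ with hγ
  have hγ' (t : ℝ) : HasDerivAt γ ξ t := by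
    simpa only [one_smul, id] using ((hasDerivAt_id t).smul_const ξ).const_add y
  have hγ0 : γ 0 = y := by simp [hγ]
  have hmax : IsLocalMax (w ∘ γ) 0 :=
    IsLocalMax.comp_continuous (by rwa [hγ0]) (hγ' 0).continuousAt
  have hderiv : deriv (w ∘ γ) = fun t => fderiv ℝ w (γ t) ξ := funext fun t =>
    ((hw.differentiable (by norm_num) _).hasFDerivAt.comp_hasDerivAt t (hγ' t)).deriv
  have hd : DifferentiableAt ℝ (fderiv ℝ w) (γ 0) :=
    (hw.fderiv_right (m := 1) (by norm_num)).differentiable (by norm_num) _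
  have hderiv2 : HasDerivAt (deriv (w ∘ γ)) (fderiv ℝ (fderiv ℝ w) y ξ ξ) 0 := by
    rw [hderiv]
    simpa [hγ0] using
      (hd.hasFDerivAt.comp_hasDerivAt 0 (hγ' 0)).clm_apply (hasDerivAt_const 0 ξ)
  rw [← hderiv2.deriv]
  exact deriv_deriv_nonpos_of_isLocalMax hmax
    (hw.continuous.continuousAt.comp (hγ' 0).continuousAt)

theorem fderiv_fderiv_nonpos_of_isLocalMax_sub {E : Type*} [NormedAddCommGroup E]
    [NormedSpace ℝ E] {w : E → ℝ} (hw : ContDiff ℝ 2 w) {ℓ : E →L[ℝ] ℝ} {y : E}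
    (hy : IsLocalMax (fun x => w x - ℓ x) y) (ξ : E) : fderiv ℝ (fderiv ℝ w) y ξ ξ ≤ 0 := by
  have h := fderiv_fderiv_nonpos_of_isLocalMax (hw.sub ℓ.contDiff) hy ξ
  have hfderiv : fderiv ℝ (fun x => w x - ℓ x) = fun x => fderiv ℝ w x - ℓ := funext fun x => by
    rw [fderiv_fun_sub (hw.differentiable (by norm_num) x) ℓ.differentiableAt, ℓ.fderiv]
  rwa [hfderiv, fderiv_sub_const] at h

/-- The upper contact set of `w` above the level `m`: the points of `Q` with `w > m` and
`D²w ≤ 0`. We do not require that the tangent plane at the point stays above the graph of `w`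
on all of `Q`. -/
def contactSet {E : Type*} [NormedAddCommGroup E] [NormedSpace ℝ E] (Q : Set E) (w : E → ℝ)
    (m : ℝ) : Set E :=
  {y ∈ Q | m < w y ∧ ∀ ξ, fderiv ℝ (fderiv ℝ w) y ξ ξ ≤ 0}

theorem measurableSet_contactSet {E : Type*} [NormedAddCommGroup E] [NormedSpace ℝ E]
    [MeasurableSpace E] [BorelSpace E] {Q : Set E} (hQ : MeasurableSet Q) {w : E → ℝ}
    (hw : ContDiff ℝ 2 w) (m : ℝ) : MeasurableSet (contactSet Q w m) := by
  have hw2 : Continuous (fderiv ℝ (fderiv ℝ w)) :=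
    (hw.fderiv_right (m := 1) (by norm_num)).continuous_fderiv (by norm_num)
  have hclosed : IsClosed {y | ∀ ξ, fderiv ℝ (fderiv ℝ w) y ξ ξ ≤ 0} := by
    rw [Set.ofPred_forall]
    exact isClosed_iInter fun ξ => isClosed_le
      ((hw2.clm_apply continuous_const).clm_apply continuous_const) continuous_const
  exact hQ.inter ((measurableSet_lt measurable_const hw.continuous.measurable).inter
    hclosed.measurableSet)

theorem ball_subset_gradient_image_contactSet {E : Type*} [NormedAddCommGroup E]
    [InnerProductSpace ℝ E] [CompleteSpace E] {Q : Set E} (hQ : IsCompact Q) {w : E → ℝ}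
    (hw : ContDiff ℝ 2 w) {m : ℝ} (hwm : ∀ x ∈ frontier Q, w x ≤ m) {x₀ : E} (hx₀ : x₀ ∈ Q) :
    Metric.ball 0 ((w x₀ - m) / Metric.diam Q) ⊆ ∇ w '' contactSet Q w m := by
  intro p hp
  rw [mem_ball_zero_iff] at hp
  have hdiam : 0 < Metric.diam Q := Metric.diam_nonneg.lt_of_ne fun h => by
    rw [← h, div_zero] at hp
    exact hp.not_ge (norm_nonneg p)
  obtain ⟨y, hyQ, hy⟩ := hQ.exists_isMaxOn ⟨x₀, hx₀⟩
    (hw.continuous.sub (innerSL ℝ p).continuous).continuousOn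
  have hmax : w x₀ - ⟪p, x₀⟫ ≤ w y - ⟪p, y⟫ := hy hx₀
  have hinner : ⟪p, x₀ - y⟫ ≤ ‖p‖ * Metric.diam Q := (real_inner_le_norm _ _).trans <| by
    rw [← dist_eq_norm]
    gcongr
    exact Metric.dist_le_diam_of_mem hQ.isBounded hx₀ hyQ
  have hwy : m < w y := by
    rw [inner_sub_right] at hinner
    linarith [(lt_div_iff₀ hdiam).mp hp]
  have hyint : y ∈ interior Q := by
    by_contra hn
    exact hwy.not_ge (hwm y ⟨subset_closure hyQ, hn⟩)
  have hloc : IsLocalMax (fun x => w x - innerSL ℝ p x) y :=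
    hy.isLocalMax (mem_interior_iff_mem_nhds.mp hyint)
  refine ⟨y, ⟨hyQ, hwy, fderiv_fderiv_nonpos_of_isLocalMax_sub hw hloc⟩, ?_⟩
  have hfderiv := hloc.fderiv_eq_zero
  rw [fderiv_fun_sub (hw.differentiable (by norm_num) y) (innerSL ℝ p).differentiableAt,
    ContinuousLinearMap.fderiv, sub_eq_zero] at hfderiv
  refine ext_inner_right ℝ fun v => ?_
  rw [inner_gradient_left, hfderiv, innerSL_apply_apply]

end ContactSet

section AreaFormula

variable {E : Type*} [NormedAddCommGroup E] [NormedSpace ℝ E] [FiniteDimensional ℝ E]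
  [MeasurableSpace E] [BorelSpace E] (μ : Measure E) [μ.IsAddHaarMeasure]

theorem setLIntegral_image_le_lintegral_abs_det_fderiv_mul {F : E → E} {F' : E → E →L[ℝ] E}
    {s : Set E} (hs : MeasurableSet s) (hF' : ∀ x ∈ s, HasFDerivWithinAt F (F' x) s x)
    (hF : Measurable F) {g : E → ℝ≥0∞} (hg : Measurable g) :
    ∫⁻ y in F '' s, g y ∂μ ≤ ∫⁻ x in s, ENNReal.ofReal |(F' x).det| * g (F x) ∂μ := by
  set D : E → ℝ≥0∞ := fun x => ENNReal.ofReal |(F' x).det|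
  have hD : AEMeasurable D (μ.restrict s) := aemeasurable_ofReal_abs_det_fderivWithin μ hs hF'
  have hle : μ.restrict (F '' s) ≤ ((μ.restrict s).withDensity D).map F := by
    refine Measure.le_iff.mpr fun A hA => ?_
    calc μ.restrict (F '' s) A = μ (F '' (s ∩ F ⁻¹' A)) := by
          rw [Measure.restrict_apply hA, Set.image_inter_preimage, Set.inter_comm]
      _ ≤ ∫⁻ x in s ∩ F ⁻¹' A, D x ∂μ :=
          addHaar_image_le_lintegral_abs_det_fderiv μ (hs.inter (hF hA)) fun x hx =>
            (hF' x hx.1).mono Set.inter_subset_left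
      _ = ((μ.restrict s).withDensity D).map F A := by
          rw [Measure.map_apply hF hA, withDensity_apply _ (hF hA),
            Measure.restrict_restrict (hF hA), Set.inter_comm]
  calc ∫⁻ y in F '' s, g y ∂μ ≤ ∫⁻ y, g y ∂((μ.restrict s).withDensity D).map F :=
        lintegral_mono' hle le_rfl
    _ = ∫⁻ x, g (F x) ∂(μ.restrict s).withDensity D := lintegral_map hg hF
    _ = ∫⁻ x in s, D x * g (F x) ∂μ :=
        lintegral_withDensity_eq_lintegral_mul₀ hD (hg.comp hF).aemeasurable

end AreaFormula

section RadialWeight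

theorem integral_pow_div_pow_add_pow {N : ℕ} (hN : N ≠ 0) {κ M : ℝ} (hκ : 0 < κ) (hM : 0 ≤ M) :
    ∫ r in 0..M, N * r ^ (N - 1) * (κ ^ N + r ^ N)⁻¹ = Real.log (1 + (M / κ) ^ N) := by
  have hpos (r : ℝ) (hr : r ∈ Set.uIcc 0 M) : 0 < κ ^ N + r ^ N := by
    rw [Set.uIcc_of_le hM] at hr
    have := hr.1
    positivity
  have hderiv (r : ℝ) (hr : r ∈ Set.uIcc 0 M) :
      HasDerivAt (fun r => Real.log (κ ^ N + r ^ N)) (N * r ^ (N - 1) * (κ ^ N + r ^ N)⁻¹) r := by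
    simpa [div_eq_mul_inv] using ((hasDerivAt_pow N r).const_add (κ ^ N)).log (hpos r hr).ne'
  have hcont : ContinuousOn (fun r => N * r ^ (N - 1) * (κ ^ N + r ^ N)⁻¹) (Set.uIcc 0 M) :=
    (by fun_prop : Continuous fun r : ℝ => N * r ^ (N - 1)).continuousOn.mul
      ((by fun_prop : Continuous fun r : ℝ => κ ^ N + r ^ N).continuousOn.inv₀
        fun r hr => (hpos r hr).ne')
  rw [intervalIntegral.integral_eq_sub_of_hasDerivAt hderiv hcont.intervalIntegrable,
    zero_pow hN, add_zero, ← Real.log_div (by positivity) (by positivity), add_div,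
    div_self (by positivity), div_pow]

theorem lintegral_ball_inv_pow_add_norm_pow {E : Type*} [NormedAddCommGroup E] [NormedSpace ℝ E]
    [FiniteDimensional ℝ E] [Nontrivial E] [MeasurableSpace E] [BorelSpace E] (μ : Measure E)
    [μ.IsAddHaarMeasure] {κ M : ℝ} (hκ : 0 < κ) (hM : 0 ≤ M) :
    ∫⁻ p in Metric.ball (0 : E) M, ENNReal.ofReal
        (κ ^ Module.finrank ℝ E + ‖p‖ ^ Module.finrank ℝ E)⁻¹ ∂μ
      = ENNReal.ofReal
          (μ.real (Metric.ball 0 1) * Real.log (1 + (M / κ) ^ Module.finrank ℝ E)) := by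
  set N := Module.finrank ℝ E
  have hint : IntegrableOn (fun p : E => (κ ^ N + ‖p‖ ^ N)⁻¹) (Metric.ball 0 M) μ := by
    have hcont : Continuous fun p : E => (κ ^ N + ‖p‖ ^ N)⁻¹ :=
      (by fun_prop : Continuous fun p : E => κ ^ N + ‖p‖ ^ N).inv₀ fun p => by positivity
    exact (hcont.continuousOn.integrableOn_compact (isCompact_closedBall 0 M)).mono_set
      Metric.ball_subset_closedBall
  rw [← ofReal_integral_eq_lintegral_ofReal hint (.of_forall fun p => by positivity)]
  congr 1
  let W : ℝ → ℝ := (Set.Iio M).indicator fun r => (κ ^ N + r ^ N)⁻¹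
  have hball : (Metric.ball (0 : E) M).indicator (fun p => (κ ^ N + ‖p‖ ^ N)⁻¹)
      = fun p => W ‖p‖ := by
    classical
    ext p
    simp only [W, Set.indicator_apply, mem_ball_zero_iff, Set.mem_Iio]
  have hradial : ∫ r in Set.Ioi (0 : ℝ), r ^ (N - 1) • W r
      = ∫ r in 0..M, r ^ (N - 1) * (κ ^ N + r ^ N)⁻¹ := by
    have hW (r : ℝ) : r ^ (N - 1) • W r
        = (Set.Iio M).indicator (fun r => r ^ (N - 1) * (κ ^ N + r ^ N)⁻¹) r := by
      rw [smul_eq_mul, Set.indicator_mul_right]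
    simp_rw [hW]
    rw [setIntegral_indicator measurableSet_Iio, Set.Ioi_inter_Iio,
      ← integral_Ioc_eq_integral_Ioo, intervalIntegral.integral_of_le hM]
  rw [← integral_indicator Metric.isOpen_ball.measurableSet, hball, integral_fun_norm_addHaar,
    hradial, ← integral_pow_div_pow_add_pow Module.finrank_pos.ne' hκ hM]
  simp only [mul_assoc, intervalIntegral.integral_const_mul, nsmul_eq_mul, smul_eq_mul]
  ring

end RadialWeight

section Classical

open scoped Gradient

theorem add_mul_pow_mul_inv_le {h β p κ : ℝ} (hh : 0 ≤ h) (hβ : 0 ≤ β) (hp : 0 ≤ p) (hκ : 0 < κ)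
    (N : ℕ) :
    (h + β * p) ^ N * (κ ^ N + p ^ N)⁻¹ ≤ 2 ^ (N - 1) * (κ⁻¹ ^ N * h ^ N + β ^ N) := by
  rw [← div_eq_mul_inv, div_le_iff₀ (by positivity)]
  have hκN : κ⁻¹ ^ N * κ ^ N = 1 := by rw [← mul_pow, inv_mul_cancel₀ hκ.ne', one_pow]
  have hcross : 0 ≤ κ⁻¹ ^ N * h ^ N * p ^ N + β ^ N * κ ^ N := by positivity
  calc (h + β * p) ^ N ≤ 2 ^ (N - 1) * (h ^ N + (β * p) ^ N) := add_pow_le hh (by positivity) N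
    _ ≤ 2 ^ (N - 1) * (h ^ N + (β * p) ^ N + (κ⁻¹ ^ N * h ^ N * p ^ N + β ^ N * κ ^ N)) :=
        mul_le_mul_of_nonneg_left (le_add_of_nonneg_right hcross) (by positivity)
    _ = 2 ^ (N - 1) * (κ⁻¹ ^ N * h ^ N + β ^ N) * (κ ^ N + p ^ N) := by
        rw [mul_pow]
        linear_combination -(2 ^ (N - 1) * h ^ N) * hκN

theorem integral_norm_pow_eq_eLpNorm_toReal_pow {α F : Type*} [MeasurableSpace α]
    [NormedAddCommGroup F] {μ : Measure α} {g : α → F} {N : ℕ} (hN : N ≠ 0) (hg : MemLp g N μ) :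
    ∫ x, ‖g x‖ ^ N ∂μ = (eLpNorm g N μ).toReal ^ N := by
  have hN' : (N : ℝ) ≠ 0 := Nat.cast_ne_zero.mpr hN
  have hint : 0 ≤ ∫ x, ‖g x‖ ^ N ∂μ := integral_nonneg fun x => by positivity
  rw [hg.eLpNorm_eq_integral_rpow_norm (Nat.cast_ne_zero.mpr hN) (ENNReal.natCast_ne_top N)]
  simp only [ENNReal.toReal_natCast, Real.rpow_natCast]
  rw [ENNReal.toReal_ofReal (by positivity), ← Real.rpow_natCast, ← Real.rpow_mul hint,
    inv_mul_cancel₀ hN', Real.rpow_one]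

/-- The constant `C` of the Aleksandrov–Bakelman–Pucci estimate
`u ≤ exp (C * (lam⁻¹ ^ N * (1 + ‖β‖ ^ N))) * diam * ‖f‖`, norms in `L^N`. -/
noncomputable def abpConst (N : ℕ) : ℝ :=
  2 ^ (N - 1) / (N * volume.real (Metric.ball (0 : EuclideanSpace ℝ (Fin N)) 1))

variable {N : ℕ} {w : EuclideanSpace ℝ (Fin N) → ℝ} {Q : Set (EuclideanSpace ℝ (Fin N))}
  {m lam : ℝ} {a : Fin N → Fin N → EuclideanSpace ℝ (Fin N) → ℝ}
  {h β : EuclideanSpace ℝ (Fin N) → ℝ} {x₀ : EuclideanSpace ℝ (Fin N)}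

theorem volume_real_ball_pos (N : ℕ) :
    0 < volume.real (Metric.ball (0 : EuclideanSpace ℝ (Fin N)) 1) :=
  ENNReal.toReal_pos (Metric.measure_ball_pos _ _ one_pos).ne' measure_ball_lt_top.ne

theorem abs_det_mul_inv_le_of_mem_contactSet (hw : ContDiff ℝ 2 w) (hlam : 0 < lam)
    {A : Fin N → Fin N → ℝ} {x : EuclideanSpace ℝ (Fin N)} {r s κ : ℝ} (hκ : 0 < κ)
    (hA : ∀ ξ : EuclideanSpace ℝ (Fin N), lam * ‖ξ‖ ^ 2 ≤ ∑ i, ∑ j, A i j * ξ i * ξ j)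
    (hx : x ∈ contactSet Q w m)
    (hL : -∑ i, ∑ j, A i j * hessian w x i j ≤ r + s * ‖∇ w x‖) :
    |(hessian w x).det| * (κ ^ N + ‖∇ w x‖ ^ N)⁻¹
      ≤ 2 ^ (N - 1) * lam⁻¹ ^ N * (κ⁻¹ ^ N * ‖r‖ ^ N + ‖s‖ ^ N) := by
  have hL' : -∑ i, ∑ j, A i j * hessian w x i j ≤ ‖r‖ + ‖s‖ * ‖∇ w x‖ :=
    hL.trans (add_le_add (le_abs_self r)
      (mul_le_mul_of_nonneg_right (le_abs_self s) (norm_nonneg _)))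
  have hdet := abs_det_le_of_posSemidef_neg hlam hA (posSemidef_neg_hessian hw hx.2.2) hL'
  rw [Fintype.card_fin, mul_pow] at hdet
  calc |(hessian w x).det| * (κ ^ N + ‖∇ w x‖ ^ N)⁻¹
      ≤ lam⁻¹ ^ N * (‖r‖ + ‖s‖ * ‖∇ w x‖) ^ N * (κ ^ N + ‖∇ w x‖ ^ N)⁻¹ := by gcongr
    _ = lam⁻¹ ^ N * ((‖r‖ + ‖s‖ * ‖∇ w x‖) ^ N * (κ ^ N + ‖∇ w x‖ ^ N)⁻¹) := mul_assoc _ _ _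
    _ ≤ lam⁻¹ ^ N * (2 ^ (N - 1) * (κ⁻¹ ^ N * ‖r‖ ^ N + ‖s‖ ^ N)) :=
        mul_le_mul_of_nonneg_left (add_mul_pow_mul_inv_le (norm_nonneg r) (norm_nonneg s)
          (norm_nonneg (∇ w x)) hκ N) (by positivity)
    _ = 2 ^ (N - 1) * lam⁻¹ ^ N * (κ⁻¹ ^ N * ‖r‖ ^ N + ‖s‖ ^ N) := by ring

theorem setLIntegral_ball_le_contactSet (hQ : IsCompact Q) (hw : ContDiff ℝ 2 w)
    (hwm : ∀ x ∈ frontier Q, w x ≤ m) (hx₀ : x₀ ∈ Q) {g : EuclideanSpace ℝ (Fin N) → ℝ≥0∞}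
    (hg : Measurable g) :
    ∫⁻ p in Metric.ball 0 ((w x₀ - m) / Metric.diam Q), g p
      ≤ ∫⁻ x in contactSet Q w m, ENNReal.ofReal |(hessian w x).det| * g (∇ w x) := by
  have hgrad : ContDiff ℝ 1 (∇ w) := contDiff_gradient hw (by norm_num)
  have hsubset := ball_subset_gradient_image_contactSet hQ hw hwm hx₀
  have harea := setLIntegral_image_le_lintegral_abs_det_fderiv_mul volume
    (measurableSet_contactSet hQ.measurableSet hw m)
    (fun x _ => (hgrad.differentiable (by norm_num) x).hasFDerivAt.hasFDerivWithinAt)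
    hgrad.continuous.measurable hg
  simp only [det_fderiv_gradient hw] at harea
  exact (lintegral_mono_set hsubset).trans harea

variable [NeZero N]

theorem abpConst_pos : 0 < abpConst N := by
  have := volume_real_ball_pos N
  have : 0 < N := NeZero.pos N
  unfold abpConst
  positivity

theorem diam_pos_of_le_frontier (hQ : IsCompact Q) (hwm : ∀ x ∈ frontier Q, w x ≤ m)
    (hx₀ : x₀ ∈ Q) (hmx₀ : m < w x₀) : 0 < Metric.diam Q := by
  have hint : x₀ ∈ interior Q := by
    by_contra hn
    exact hmx₀.not_ge (hwm x₀ ⟨subset_closure hx₀, hn⟩)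
  exact Metric.diam_pos (infinite_of_mem_nhds x₀ (mem_interior_iff_mem_nhds.mp hint)).nontrivial
    hQ.isBounded

theorem mul_log_one_add_pow_le (hQ : IsCompact Q) (hw : ContDiff ℝ 2 w)
    (hwm : ∀ x ∈ frontier Q, w x ≤ m) (hlam : 0 < lam)
    (ha : ∀ᵐ x ∂volume.restrict Q, ∀ ξ : EuclideanSpace ℝ (Fin N),
      lam * ‖ξ‖ ^ 2 ≤ ∑ i, ∑ j, a i j x * ξ i * ξ j)
    (hh : MemLp h N (volume.restrict Q)) (hβ : MemLp β N (volume.restrict Q))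
    (hL : ∀ᵐ x ∂volume.restrict Q, m < w x →
      -∑ i, ∑ j, a i j x * hessian w x i j ≤ h x + β x * ‖∇ w x‖)
    (hx₀ : x₀ ∈ Q) (hmx₀ : m ≤ w x₀) {κ : ℝ} (hκ : 0 < κ) :
    volume.real (Metric.ball (0 : EuclideanSpace ℝ (Fin N)) 1)
        * Real.log (1 + ((w x₀ - m) / Metric.diam Q / κ) ^ N)
      ≤ 2 ^ (N - 1) * lam⁻¹ ^ N * (κ⁻¹ ^ N * (eLpNorm h N (volume.restrict Q)).toReal ^ N
        + (eLpNorm β N (volume.restrict Q)).toReal ^ N) := by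
  have : Nontrivial (EuclideanSpace ℝ (Fin N)) :=
    Module.nontrivial_of_finrank_pos (R := ℝ) (by simpa using NeZero.pos N)
  let R (x : EuclideanSpace ℝ (Fin N)) : ℝ :=
    2 ^ (N - 1) * lam⁻¹ ^ N * (κ⁻¹ ^ N * ‖h x‖ ^ N + ‖β x‖ ^ N)
  have hR0 (x : EuclideanSpace ℝ (Fin N)) : 0 ≤ R x := by positivity
  have hhN := (hh.integrable_norm_pow (NeZero.ne N)).const_mul (κ⁻¹ ^ N)
  have hβN := hβ.integrable_norm_pow (NeZero.ne N)
  have hRint : Integrable R (volume.restrict Q) := (hhN.add hβN).const_mul _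
  have hR : ∫ x in Q, R x = 2 ^ (N - 1) * lam⁻¹ ^ N
      * (κ⁻¹ ^ N * (eLpNorm h N (volume.restrict Q)).toReal ^ N
        + (eLpNorm β N (volume.restrict Q)).toReal ^ N) := by
    rw [integral_const_mul, integral_add hhN hβN, integral_const_mul,
      integral_norm_pow_eq_eLpNorm_toReal_pow (NeZero.ne N) hh,
      integral_norm_pow_eq_eLpNorm_toReal_pow (NeZero.ne N) hβ]
  have hball := lintegral_ball_inv_pow_add_norm_pow
    (volume : Measure (EuclideanSpace ℝ (Fin N))) hκ
    (div_nonneg (sub_nonneg.mpr hmx₀) (Metric.diam_nonneg (s := Q)))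
  rw [finrank_euclideanSpace_fin] at hball
  rw [← hR, ← ENNReal.ofReal_le_ofReal_iff (integral_nonneg hR0), ← hball,
    ofReal_integral_eq_lintegral_ofReal hRint (.of_forall hR0)]
  have hΓ : MeasurableSet (contactSet Q w m) := measurableSet_contactSet hQ.measurableSet hw m
  have hΓQ : contactSet Q w m ⊆ Q := Set.sep_subset _ _
  refine (setLIntegral_ball_le_contactSet hQ hw hwm hx₀ (by fun_prop)).trans
    ((lintegral_mono_ae ?_).trans (lintegral_mono_set hΓQ))
  filter_upwards [ae_restrict_of_ae_restrict_of_subset hΓQ ha,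
    ae_restrict_of_ae_restrict_of_subset hΓQ hL, ae_restrict_mem hΓ] with x hax hLx hxΓ
  rw [← ENNReal.ofReal_mul (abs_nonneg _)]
  exact ENNReal.ofReal_le_ofReal
    (abs_det_mul_inv_le_of_mem_contactSet hw hlam hκ hax hxΓ (hLx hxΓ.2.1))

theorem abp_estimate_of_contDiff (hQ : IsCompact Q) (hw : ContDiff ℝ 2 w)
    (hwm : ∀ x ∈ frontier Q, w x ≤ m) (hlam : 0 < lam)
    (ha : ∀ᵐ x ∂volume.restrict Q, ∀ ξ : EuclideanSpace ℝ (Fin N),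
      lam * ‖ξ‖ ^ 2 ≤ ∑ i, ∑ j, a i j x * ξ i * ξ j)
    (hh : MemLp h N (volume.restrict Q)) (hβ : MemLp β N (volume.restrict Q))
    (hL : ∀ᵐ x ∂volume.restrict Q, m < w x →
      -∑ i, ∑ j, a i j x * hessian w x i j ≤ h x + β x * ‖∇ w x‖)
    (hx₀ : x₀ ∈ Q) :
    w x₀ ≤ m + Real.exp (abpConst N *
        (lam⁻¹ ^ N * (1 + (eLpNorm β N (volume.restrict Q)).toReal ^ N)))
      * Metric.diam Q * (eLpNorm h N (volume.restrict Q)).toReal := by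
  set A := (eLpNorm h N (volume.restrict Q)).toReal
  set B := (eLpNorm β N (volume.restrict Q)).toReal
  set X := abpConst N * (lam⁻¹ ^ N * (1 + B ^ N)) with hX
  have hA : 0 ≤ A := ENNReal.toReal_nonneg
  rcases le_or_gt (w x₀) m with hle | hmx₀
  · exact hle.trans (le_add_of_nonneg_right (by positivity))
  have hdiam := diam_pos_of_le_frontier hQ hwm hx₀ hmx₀
  set t := (w x₀ - m) / Metric.diam Q with ht
  have : 0 < t := div_pos (sub_pos.mpr hmx₀) hdiam
  have hN : (0 : ℝ) < N := Nat.cast_pos.mpr (NeZero.pos N)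
  set v := volume.real (Metric.ball (0 : EuclideanSpace ℝ (Fin N)) 1) with hv
  have hv0 : 0 < v := volume_real_ball_pos N
  have hκ (κ : ℝ) (hAκ : A < κ) : t / Real.exp X ≤ κ := by
    have hκ0 : 0 < κ := hA.trans_lt hAκ
    have hlog : N * Real.log (t / κ) ≤ Real.log (1 + (t / κ) ^ N) := by
      rw [← Real.log_pow]
      exact Real.log_le_log (by positivity) (by linarith)
    have hAκ1 : κ⁻¹ ^ N * A ^ N ≤ 1 := by
      rw [← mul_pow]
      exact pow_le_one₀ (by positivity) ((inv_mul_le_one₀ hκ0).mpr hAκ.le)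
    have hest : Real.log (t / κ) ≤ X := by
      rw [hX, abpConst, ← hv, div_mul_eq_mul_div, le_div_iff₀ (by positivity)]
      calc Real.log (t / κ) * (N * v) = v * (N * Real.log (t / κ)) := by ring
        _ ≤ v * Real.log (1 + (t / κ) ^ N) := by gcongr
        _ ≤ 2 ^ (N - 1) * lam⁻¹ ^ N * (κ⁻¹ ^ N * A ^ N + B ^ N) :=
            mul_log_one_add_pow_le hQ hw hwm hlam ha hh hβ hL hx₀ hmx₀.le hκ0
        _ ≤ 2 ^ (N - 1) * (lam⁻¹ ^ N * (1 + B ^ N)) := by rw [mul_assoc]; gcongr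
    rw [Real.log_le_iff_le_exp (by positivity), div_le_iff₀ hκ0] at hest
    rwa [div_le_iff₀' (Real.exp_pos X)]
  have htA : t ≤ A * Real.exp X :=
    (div_le_iff₀ (Real.exp_pos X)).mp (le_of_forall_gt_imp_ge_of_dense hκ)
  rw [ht, div_le_iff₀ hdiam] at htA
  linarith

end Classical

section Minkowski

variable {α T F : Type*} [MeasurableSpace α] [MeasurableSpace T] [NormedAddCommGroup F]
  [NormedSpace ℝ F] {μ : Measure α} {ρ : Measure T} [IsProbabilityMeasure ρ] {K : T → α → F}
  {p : ℝ≥0∞} {C : ℝ≥0∞}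

theorem enorm_integral_rpow_le_lintegral {g : T → F} (hg : AEStronglyMeasurable g ρ) {q : ℝ}
    (hq : 1 ≤ q) : ‖∫ t, g t ∂ρ‖ₑ ^ q ≤ ∫⁻ t, ‖g t‖ₑ ^ q ∂ρ := by
  have hq₀ : 0 < q := zero_lt_one.trans_le hq
  have h_exponents := eLpNorm'_le_eLpNorm'_of_exponent_le one_pos hq ρ hg
  simp only [eLpNorm', ENNReal.rpow_one, div_one] at h_exponents
  calc ‖∫ t, g t ∂ρ‖ₑ ^ q ≤ ((∫⁻ t, ‖g t‖ₑ ^ q ∂ρ) ^ (1 / q)) ^ q :=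
        ENNReal.rpow_le_rpow ((enorm_integral_le_lintegral_enorm _).trans h_exponents) hq₀.le
    _ = ∫⁻ t, ‖g t‖ₑ ^ q ∂ρ := by
        rw [← ENNReal.rpow_mul, one_div_mul_cancel hq₀.ne', ENNReal.rpow_one]

theorem eLpNorm_integral_le [SFinite μ]
    (hK : AEStronglyMeasurable (fun z : α × T => K z.2 z.1) (μ.prod ρ)) (hp : 1 ≤ p) (hp' : p ≠ ⊤)
    (hC : ∀ᵐ t ∂ρ, eLpNorm (K t) p μ ≤ C) : eLpNorm (fun x => ∫ t, K t x ∂ρ) p μ ≤ C := by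
  have hp₀ : p ≠ 0 := (zero_lt_one.trans_le hp).ne'
  have hq : 1 ≤ p.toReal := by simpa using ENNReal.toReal_mono hp' hp
  have hq₀ : 0 < p.toReal := zero_lt_one.trans_le hq
  simp only [eLpNorm_eq_lintegral_rpow_enorm_toReal hp₀ hp', one_div,
    ENNReal.rpow_inv_le_iff hq₀] at hC ⊢
  calc ∫⁻ x, ‖∫ t, K t x ∂ρ‖ₑ ^ p.toReal ∂μ
      ≤ ∫⁻ x, ∫⁻ t, ‖K t x‖ₑ ^ p.toReal ∂ρ ∂μ := by
        refine lintegral_mono_ae ?_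
        filter_upwards [hK.prodMk_left] with x hx using enorm_integral_rpow_le_lintegral hx hq
    _ = ∫⁻ t, ∫⁻ x, ‖K t x‖ₑ ^ p.toReal ∂μ ∂ρ :=
        lintegral_lintegral_swap (hK.enorm.pow_const p.toReal)
    _ ≤ ∫⁻ _, C ^ p.toReal ∂ρ := lintegral_mono_ae hC
    _ = C ^ p.toReal := by simp

end Minkowski

section Translation

open Filter Topology

variable {E F : Type*} [NormedAddCommGroup E] [NormedSpace ℝ E] [FiniteDimensional ℝ E]
  [MeasurableSpace E] [BorelSpace E] {μ : Measure E} [μ.IsAddHaarMeasure] [NormedAddCommGroup F]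

theorem tendsto_eLpNorm_comp_sub_sub {p : ℝ≥0∞} (hp : 1 ≤ p) (hp' : p ≠ ⊤) {g : E → F}
    (hg : MemLp g p μ) :
    Tendsto (fun t => eLpNorm (fun x => g (x - t) - g x) p μ) (𝓝 0) (𝓝 0) := by
  have := Fact.mk hp
  have := Fact.mk hp'
  have h_cont : Continuous fun t : E => DomAddAct.mk (-t) +ᵥ hg.toLp g :=
    DomAddAct.continuous_mk.comp continuous_neg |>.vadd continuous_const
  have h_tendsto : Tendsto (fun t : E => edist (DomAddAct.mk (-t) +ᵥ hg.toLp g) (hg.toLp g)) (𝓝 0)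
      (𝓝 0) := by
    simpa only [neg_zero, DomAddAct.mk_zero, zero_vadd, edist_self] using
      (h_cont.edist (continuous_const (y := hg.toLp g))).tendsto 0
  refine h_tendsto.congr fun t => ?_
  rw [DomAddAct.mk_vadd_toLp, Lp.edist_toLp_toLp]
  congr 1 with x
  simp [sub_eq_neg_add]

end Translation

section Mollification

open Filter Topology

variable {E F : Type*} [NormedAddCommGroup E] [NormedSpace ℝ E] [MeasurableSpace E] [BorelSpace E]
  [HasContDiffBump E] [NormedAddCommGroup F] [NormedSpace ℝ F] {μ : Measure E}
  {φ : ContDiffBump (0 : E)} {g : E → F}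

/-- The mollification of `g` by the bump function `φ`, normalized with respect to `μ`. -/
noncomputable def mollify (μ : Measure E) (φ : ContDiffBump (0 : E)) (g : E → F) : E → F :=
  convolution (φ.normed μ) g (ContinuousLinearMap.lsmul ℝ ℝ) μ

/-- The probability measure on `E` whose density is the normalized bump function `φ`. -/
noncomputable def bumpMeasure (φ : ContDiffBump (0 : E)) (μ : Measure E) : Measure E :=
  μ.withDensity fun t => ENNReal.ofReal (φ.normed μ t)

theorem measurable_ofReal_normed : Measurable fun t => ENNReal.ofReal (φ.normed μ t) :=
  φ.continuous_normed.measurable.ennreal_ofReal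

theorem integrable_bumpMeasure_iff {k : E → F} :
    Integrable k (bumpMeasure φ μ) ↔ Integrable (fun t => φ.normed μ t • k t) μ := by
  simp [bumpMeasure, integrable_withDensity_iff_integrable_smul' measurable_ofReal_normed,
    ENNReal.toReal_ofReal (φ.nonneg_normed _)]

theorem mollify_eq_integral_bumpMeasure (x : E) :
    mollify μ φ g x = ∫ t, g (x - t) ∂bumpMeasure φ μ := by
  simp [mollify, convolution_def, bumpMeasure, integral_withDensity_eq_integral_toReal_smul
    measurable_ofReal_normed, ENNReal.toReal_ofReal (φ.nonneg_normed _)]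

variable [FiniteDimensional ℝ E] [μ.IsAddHaarMeasure]

theorem contDiff_mollify (hg : LocallyIntegrable g μ) {n : ℕ∞} : ContDiff ℝ n (mollify μ φ g) :=
  φ.hasCompactSupport_normed.contDiff_convolution_left _ φ.contDiff_normed hg

theorem dist_mollify_le [CompleteSpace F] (hg : AEStronglyMeasurable g μ) {x : E} {ε : ℝ}
    (h : ∀ y ∈ Metric.ball x φ.rOut, dist (g y) (g x) ≤ ε) : dist (mollify μ φ g x) (g x) ≤ ε :=
  ContDiffBump.dist_normed_convolution_le hg h

instance isProbabilityMeasure_bumpMeasure : IsProbabilityMeasure (bumpMeasure φ μ) := by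
  refine ⟨?_⟩
  rw [bumpMeasure, withDensity_apply _ .univ, Measure.restrict_univ,
    ← ofReal_integral_eq_lintegral_ofReal φ.integrable_normed (.of_forall φ.nonneg_normed),
    φ.integral_normed, ENNReal.ofReal_one]

theorem ae_bumpMeasure_mem_ball : ∀ᵐ t ∂bumpMeasure φ μ, t ∈ Metric.ball 0 φ.rOut := by
  refine (ae_withDensity_iff measurable_ofReal_normed).mpr (.of_forall fun t ht => ?_)
  rw [← φ.support_normed_eq (μ := μ), Function.mem_support]
  exact fun h => ht (by rw [h, ENNReal.ofReal_zero])

theorem mollify_sub_eq_integral_bumpMeasure [CompleteSpace F] (hg : LocallyIntegrable g μ) (x : E) :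
    mollify μ φ g x - g x = ∫ t, (g (x - t) - g x) ∂bumpMeasure φ μ := by
  have h_int : Integrable (fun t => g (x - t)) (bumpMeasure φ μ) :=
    integrable_bumpMeasure_iff.mpr <| φ.hasCompactSupport_normed.convolutionExists_left
      (ContinuousLinearMap.lsmul ℝ ℝ) φ.continuous_normed hg x
  rw [integral_sub h_int (integrable_const _), ← mollify_eq_integral_bumpMeasure]
  simp

theorem tendsto_eLpNorm_mollify_sub [CompleteSpace F] {p : ℝ≥0∞} (hp : 1 ≤ p) (hp' : p ≠ ⊤)
    (hg : MemLp g p μ) {ι : Type*} {l : Filter ι} {φ : ι → ContDiffBump (0 : E)}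
    (hφ : Tendsto (fun k => (φ k).rOut) l (𝓝 0)) :
    Tendsto (fun k => eLpNorm (mollify μ (φ k) g - g) p μ) l (𝓝 0) := by
  refine ENNReal.tendsto_nhds_zero.mpr fun ε hε => ?_
  obtain ⟨δ, hδ, h_transl⟩ := Metric.eventually_nhds_iff_ball.mp
    (ENNReal.tendsto_nhds_zero.mp (tendsto_eLpNorm_comp_sub_sub hp hp' hg) ε hε)
  filter_upwards [hφ.eventually_lt_const hδ] with k hk
  have h_eq : mollify μ (φ k) g - g = fun x => ∫ t, (g (x - t) - g x) ∂bumpMeasure (φ k) μ :=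
    funext fun x => mollify_sub_eq_integral_bumpMeasure (hg.locallyIntegrable hp) x
  rw [h_eq]
  refine eLpNorm_integral_le ?_ hp hp' ?_
  · have : bumpMeasure (φ k) μ ≪ μ := withDensity_absolutelyContinuous _ _
    exact (hg.1.comp_quasiMeasurePreserving (quasiMeasurePreserving_sub μ _)).sub hg.1.comp_fst
  · filter_upwards [ae_bumpMeasure_mem_ball] with t ht
    exact h_transl t (Metric.ball_subset_ball hk.le ht)

end Mollification

section MollifyIndicator

open Filter Topology

variable {E : Type*} [NormedAddCommGroup E] [NormedSpace ℝ E] [FiniteDimensional ℝ E]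
  [MeasurableSpace E] [BorelSpace E] {μ : Measure E} [μ.IsAddHaarMeasure]
  {F : Type*} [NormedAddCommGroup F] [NormedSpace ℝ F] [CompleteSpace F]
  {g : E → F} {K K' : Set E} {ι : Type*} {l : Filter ι} {φ : ι → ContDiffBump (0 : E)}

theorem tendstoUniformlyOn_mollify_indicator (hK' : IsCompact K') (hg : ContinuousOn g K') {δ : ℝ}
    (hδ : 0 < δ) (hKK' : ∀ x ∈ K, Metric.closedBall x δ ⊆ K')
    (hφ : Tendsto (fun k => (φ k).rOut) l (𝓝 0)) :
    TendstoUniformlyOn (fun k => mollify μ (φ k) (K'.indicator g)) g l K := by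
  rw [Metric.tendstoUniformlyOn_iff]
  intro ε hε
  obtain ⟨r, hr, h_unif⟩ := Metric.uniformContinuousOn_iff.mp
    (hK'.uniformContinuousOn_of_continuous hg) (ε / 2) (half_pos hε)
  filter_upwards [hφ.eventually_lt_const (lt_min hr hδ)] with k hk x hx
  obtain ⟨hkr, hkδ⟩ := lt_min_iff.mp hk
  have hxK' : x ∈ K' := hKK' x hx (Metric.mem_closedBall_self hδ.le)
  have h_meas : AEStronglyMeasurable (K'.indicator g) μ :=
    (aestronglyMeasurable_indicator_iff hK'.measurableSet).mpr
      (hg.aestronglyMeasurable_of_isCompact hK' hK'.measurableSet)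
  have h_osc : ∀ y ∈ Metric.ball x (φ k).rOut,
      dist (K'.indicator g y) (K'.indicator g x) ≤ ε / 2 := fun y hy => by
    have hyK' : y ∈ K' := hKK' x hx (Metric.ball_subset_closedBall.trans
      (Metric.closedBall_subset_closedBall hkδ.le) hy)
    rw [Set.indicator_of_mem hyK', Set.indicator_of_mem hxK']
    exact (h_unif y hyK' x hxK' (hy.trans hkr)).le
  have h_dist := dist_mollify_le h_meas h_osc
  rw [Set.indicator_of_mem hxK', dist_comm] at h_dist
  exact h_dist.trans_lt (half_lt_self hε)

theorem tendsto_eLpNorm_mollify_indicator_sub (hK : MeasurableSet K) (hK' : MeasurableSet K')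
    (hKK' : K ⊆ K') {p : ℝ≥0∞} (hp : 1 ≤ p) (hp' : p ≠ ⊤) (hg : MemLp g p (μ.restrict K'))
    (hφ : Tendsto (fun k => (φ k).rOut) l (𝓝 0)) :
    Tendsto (fun k => eLpNorm (mollify μ (φ k) (K'.indicator g) - g) p (μ.restrict K)) l
      (𝓝 0) := by
  have h_mem : MemLp (K'.indicator g) p μ := (memLp_indicator_iff_restrict hK').mpr hg
  have h_tendsto := tendsto_eLpNorm_mollify_sub hp hp' h_mem hφ
  refine tendsto_of_tendsto_of_tendsto_of_le_of_le tendsto_const_nhds h_tendsto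
    (fun _ => zero_le) fun k => ?_
  calc eLpNorm (mollify μ (φ k) (K'.indicator g) - g) p (μ.restrict K)
      = eLpNorm (mollify μ (φ k) (K'.indicator g) - K'.indicator g) p (μ.restrict K) := by
        refine eLpNorm_congr_ae ?_
        filter_upwards [ae_restrict_mem hK] with x hx
        rw [Pi.sub_apply, Pi.sub_apply, Set.indicator_of_mem (hKK' hx)]
    _ ≤ eLpNorm (mollify μ (φ k) (K'.indicator g) - K'.indicator g) p μ :=
        eLpNorm_restrict_le _ p μ K

end MollifyIndicator

section FDerivMollify

variable {E : Type*} [NormedAddCommGroup E] [NormedSpace ℝ E] [MeasurableSpace E]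
  [FiniteDimensional ℝ E] {μ : Measure E} {φ : ContDiffBump (0 : E)}

theorem contDiff_normed_const_sub (x : E) : ContDiff ℝ ∞ fun t => φ.normed μ (x - t) :=
  φ.contDiff_normed.comp (contDiff_const.sub contDiff_id)

theorem fderiv_normed_const_sub (x t : E) :
    fderiv ℝ (fun t => φ.normed μ (x - t)) t = -fderiv ℝ (φ.normed μ) (x - t) := by
  have h_diff : DifferentiableAt ℝ (φ.normed μ) (x - t) :=
    (φ.contDiff_normed (n := 1)).differentiable one_ne_zero _
  have h_comp := h_diff.hasFDerivAt.comp t ((hasFDerivAt_id t).const_sub x)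
  simpa [Function.comp_def] using h_comp.fderiv

variable [BorelSpace E] [μ.IsAddHaarMeasure]

theorem tsupport_normed_const_sub_subset (x : E) :
    tsupport (fun t => φ.normed μ (x - t)) ⊆ Metric.closedBall x φ.rOut := by
  refine closure_minimal (fun t ht => ?_) Metric.isClosed_closedBall
  have h_mem : x - t ∈ Function.support (φ.normed μ) := ht
  rw [φ.support_normed_eq, mem_ball_zero_iff] at h_mem
  rw [Metric.mem_closedBall, dist_comm, dist_eq_norm]
  exact h_mem.le

theorem hasCompactSupport_normed_const_sub (x : E) :
    HasCompactSupport fun t => φ.normed μ (x - t) :=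
  (isCompact_closedBall x φ.rOut).of_isClosed_subset (isClosed_tsupport _)
    (tsupport_normed_const_sub_subset x)

theorem fderiv_mollify_apply {F : Type*} [NormedAddCommGroup F] [NormedSpace ℝ F] {g : E → F}
    (hg : LocallyIntegrable g μ) (x e : E) :
    fderiv ℝ (mollify μ φ g) x e = ∫ t, fderiv ℝ (φ.normed μ) (x - t) e • g t ∂μ := by
  have hφ : ContDiff ℝ 1 (φ.normed μ) := φ.contDiff_normed
  have hφ_supp : HasCompactSupport (φ.normed μ) := φ.hasCompactSupport_normed
  have h_conv := (hφ_supp.fderiv (𝕜 := ℝ)).convolutionExists_left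
    ((ContinuousLinearMap.lsmul ℝ ℝ : ℝ →L[ℝ] F →L[ℝ] F).precompL E)
    (hφ.continuous_fderiv one_ne_zero) hg x
  rw [mollify, (hφ_supp.hasFDerivAt_convolution_left _ hφ hg x).fderiv, convolution_def,
    ContinuousLinearMap.integral_apply h_conv, ← integral_sub_left_eq_self _ μ x]
  simp [ContinuousLinearMap.precompL_apply]

end FDerivMollify

section WeakDerivative

open Filter Topology

theorem integrable_indicator_of_isCompact {E F : Type*} [TopologicalSpace E] [MeasurableSpace E]
    [OpensMeasurableSpace E] [T2Space E] [NormedAddCommGroup F] {μ : Measure E} {u : E → F}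
    {Ω K : Set E} (hu : LocallyIntegrableOn u Ω μ) (hK : IsCompact K) (hKΩ : K ⊆ Ω) :
    Integrable (K.indicator u) μ :=
  (integrable_indicator_iff hK.measurableSet).mpr (hu.integrableOn_compact_subset hKΩ hK)

theorem setIntegral_mul_eq_integral_indicator_mul {E : Type*} [TopologicalSpace E]
    [MeasurableSpace E] {μ : Measure E} {Ω K : Set E} (hKΩ : K ⊆ Ω) {u θ : E → ℝ}
    (hθ : tsupport θ ⊆ K) : ∫ x in Ω, u x * θ x ∂μ = ∫ x, K.indicator u x * θ x ∂μ := by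
  have hθ_zero : ∀ x ∉ K, θ x = 0 := fun x hx =>
    image_eq_zero_of_notMem_tsupport fun hx' => hx (hθ hx')
  rw [setIntegral_eq_integral_of_forall_compl_eq_zero fun x hx => by
    rw [hθ_zero x fun hxK => hx (hKΩ hxK), mul_zero]]
  refine integral_congr_ae (.of_forall fun x => ?_)
  by_cases hx : x ∈ K
  · simp [hx]
  · simp [hθ_zero x hx]

variable {N : ℕ} {Ω K : Set (EuclideanSpace ℝ (Fin N))} {i j : Fin N}
  {u v w : EuclideanSpace ℝ (Fin N) → ℝ} {φ : ContDiffBump (0 : EuclideanSpace ℝ (Fin N))}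
  {x : EuclideanSpace ℝ (Fin N)}

-- The weak derivative is tested against the reflected bump function `t ↦ φ (x - t)`.
theorem HasWeakPartial.fderiv_mollify_indicator (h : HasWeakPartial Ω i u v) (hK : IsCompact K)
    (hKΩ : K ⊆ Ω) (hx : Metric.closedBall x φ.rOut ⊆ K) :
    fderiv ℝ (mollify volume φ (K.indicator u)) x (EuclideanSpace.single i 1)
      = mollify volume φ (K.indicator v) x := by
  have h_supp := (tsupport_normed_const_sub_subset (μ := volume) x).trans hx
  have h_test := h.integral_eq _ (contDiff_normed_const_sub x)
    (hasCompactSupport_normed_const_sub x) (h_supp.trans hKΩ)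
  rw [setIntegral_mul_eq_integral_indicator_mul hKΩ
      ((tsupport_fderiv_apply_subset ℝ (EuclideanSpace.single i 1)).trans h_supp),
    setIntegral_mul_eq_integral_indicator_mul hKΩ h_supp] at h_test
  simp only [fderiv_normed_const_sub, neg_apply, mul_neg, integral_neg, neg_inj] at h_test
  rw [fderiv_mollify_apply
    (integrable_indicator_of_isCompact h.locallyIntegrable hK hKΩ).locallyIntegrable,
    mollify, convolution_eq_swap]
  simpa only [ContinuousLinearMap.lsmul_apply, smul_eq_mul, mul_comm] using h_test

theorem hessian_apply_eq_fderiv_fderiv_apply (hw : ContDiff ℝ 2 w)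
    (x : EuclideanSpace ℝ (Fin N)) (i j : Fin N) :
    hessian w x i j = fderiv ℝ (fun y => fderiv ℝ w y (EuclideanSpace.single j 1)) x
      (EuclideanSpace.single i 1) := by
  have h_diff : DifferentiableAt ℝ (fderiv ℝ w) x :=
    (hw.fderiv_right (m := 1) (by norm_num)).differentiable one_ne_zero x
  simp [hessian, fderiv_clm_apply h_diff (differentiableAt_const _)]

theorem HasWeakPartial.hessian_mollify_indicator (h : HasWeakPartial Ω j u v)
    (h' : HasWeakPartial Ω i v w) (hK : IsCompact K) (hKΩ : K ⊆ Ω) {δ : ℝ} (hφ : φ.rOut < δ)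
    (hx : Metric.closedBall x δ ⊆ K) :
    hessian (mollify volume φ (K.indicator u)) x i j = mollify volume φ (K.indicator w) x := by
  have h_near : (fun y => fderiv ℝ (mollify volume φ (K.indicator u)) y
      (EuclideanSpace.single j 1)) =ᶠ[𝓝 x] mollify volume φ (K.indicator v) := by
    filter_upwards [Metric.ball_mem_nhds x (sub_pos.mpr hφ)] with y hy
    refine h.fderiv_mollify_indicator hK hKΩ ((Metric.closedBall_subset_closedBall' ?_).trans hx)
    linarith [Metric.mem_ball.mp hy]
  have h_smooth : ContDiff ℝ 2 (mollify volume φ (K.indicator u)) :=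
    contDiff_mollify (n := 2)
      (integrable_indicator_of_isCompact h.locallyIntegrable hK hKΩ).locallyIntegrable
  rw [hessian_apply_eq_fderiv_fderiv_apply h_smooth, h_near.fderiv_eq]
  exact h'.fderiv_mollify_indicator hK hKΩ ((Metric.closedBall_subset_closedBall hφ.le).trans hx)

end WeakDerivative

section Approximation

open Filter Topology
open scoped Gradient

variable {α : Type*} [MeasurableSpace α] {μ : Measure α} {p : ℝ≥0∞}

theorem ae_eq_of_tendsto_eLpNorm_sub {F : Type*} [NormedAddCommGroup F] (hp : p ≠ 0)
    {v : ℕ → α → F} {g g' : α → F} (hv : ∀ k, AEStronglyMeasurable (v k) μ)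
    (hg : AEStronglyMeasurable g μ) (hg' : AEStronglyMeasurable g' μ)
    (h : Tendsto (fun k => eLpNorm (v k - g) p μ) atTop (𝓝 0))
    (h' : Tendsto (fun k => eLpNorm (v k - g') p μ) atTop (𝓝 0)) : g =ᵐ[μ] g' :=
  tendstoInMeasure_ae_unique (tendstoInMeasure_of_tendsto_eLpNorm hp hv hg h)
    (tendstoInMeasure_of_tendsto_eLpNorm hp hv hg' h')

theorem tendsto_eLpNorm_sum {F ι κ : Type*} [NormedAddCommGroup F] {s : Finset ι} {l : Filter κ}
    {g : κ → ι → α → F} (hp : 1 ≤ p) (hg : ∀ k, ∀ i ∈ s, AEStronglyMeasurable (g k i) μ)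
    (h : ∀ i ∈ s, Tendsto (fun k => eLpNorm (g k i) p μ) l (𝓝 0)) :
    Tendsto (fun k => eLpNorm (∑ i ∈ s, g k i) p μ) l (𝓝 0) := by
  have h_sum : Tendsto (fun k => ∑ i ∈ s, eLpNorm (g k i) p μ) l (𝓝 0) := by
    simpa using tendsto_finsetSum s h
  exact tendsto_of_tendsto_of_tendsto_of_le_of_le tendsto_const_nhds h_sum (fun _ => zero_le)
    fun k => eLpNorm_sum_le (hg k) hp

theorem tendsto_eLpNorm_const_smul {F κ : Type*} [NormedAddCommGroup F] [NormedSpace ℝ F]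
    {l : Filter κ} {g : κ → α → F} (r : ℝ) (h : Tendsto (fun k => eLpNorm (g k) p μ) l (𝓝 0)) :
    Tendsto (fun k => eLpNorm (r • g k) p μ) l (𝓝 0) := by
  simpa [eLpNorm_const_smul] using ENNReal.Tendsto.const_mul h (.inr enorm_ne_top)

variable {N : ℕ} {Ω K : Set (EuclideanSpace ℝ (Fin N))} {u : EuclideanSpace ℝ (Fin N) → ℝ}
  {Du : Fin N → EuclideanSpace ℝ (Fin N) → ℝ}
  {D2u : Fin N → Fin N → EuclideanSpace ℝ (Fin N) → ℝ}

theorem IsW2Loc.exists_seq_contDiff_tendsto (hu : IsW2Loc p Ω u Du D2u) (hp : 1 ≤ p) (hp' : p ≠ ⊤)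
    (huc : ContinuousOn u Ω) (hΩ : IsOpen Ω) (hK : IsCompact K) (hKΩ : K ⊆ Ω) :
    ∃ w : ℕ → EuclideanSpace ℝ (Fin N) → ℝ, (∀ k, ContDiff ℝ 2 (w k)) ∧
      TendstoUniformlyOn w u atTop K ∧
      (∀ i, Tendsto (fun k => eLpNorm (fun x => ∇ (w k) x i - Du i x) p (volume.restrict K))
        atTop (𝓝 0)) ∧
      ∀ i j, Tendsto (fun k => eLpNorm (fun x => hessian (w k) x i j - D2u i j x) p
        (volume.restrict K)) atTop (𝓝 0) := by
  obtain ⟨δ, hδ, hδΩ⟩ := hK.exists_cthickening_subset_open hΩ hKΩ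
  set K' := Metric.cthickening δ K
  have hK' : IsCompact K' := hK.cthickening
  have hKK' : K ⊆ K' := Metric.self_subset_cthickening K
  have h_ball : ∀ x ∈ K, Metric.closedBall x δ ⊆ K' :=
    fun x hx => Metric.closedBall_subset_cthickening hx δ
  let φ : ℕ → ContDiffBump (0 : EuclideanSpace ℝ (Fin N)) := fun k =>
    ⟨δ / (k + 3), δ / (k + 2), by positivity, by gcongr; norm_num⟩
  have hφδ (k : ℕ) : (φ k).rOut < δ := div_lt_self hδ (by linarith [k.cast_nonneg (α := ℝ)])
  have hφ : Tendsto (fun k => (φ k).rOut) atTop (𝓝 0) :=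
    tendsto_const_nhds.div_atTop (tendsto_atTop_add_const_right _ _ tendsto_natCast_atTop_atTop)
  have h_int : LocallyIntegrable (K'.indicator u) volume :=
    ((integrable_indicator_iff hK'.measurableSet).mpr
      ((huc.mono hδΩ).integrableOn_compact hK')).locallyIntegrable
  have h_tendsto {g : EuclideanSpace ℝ (Fin N) → ℝ} (hg : MemLpLoc p Ω g) :=
    tendsto_eLpNorm_mollify_indicator_sub hK.measurableSet hK'.measurableSet hKK' hp hp'
      (hg K' hK' hδΩ) hφ
  refine ⟨fun k => mollify volume (φ k) (K'.indicator u), fun k => contDiff_mollify (n := 2) h_int,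
    tendstoUniformlyOn_mollify_indicator hK' (huc.mono hδΩ) hδ h_ball hφ, fun i => ?_,
    fun i j => ?_⟩
  · refine (h_tendsto (hu.memLp_grad i)).congr fun k => eLpNorm_congr_ae ?_
    filter_upwards [ae_restrict_mem hK.measurableSet] with x hx
    rw [gradient_apply, (hu.weak_grad i).fderiv_mollify_indicator hK' hδΩ
      ((Metric.closedBall_subset_closedBall (hφδ k).le).trans (h_ball x hx)), Pi.sub_apply]
  · refine (h_tendsto (hu.memLp_hess i j)).congr fun k => eLpNorm_congr_ae ?_
    filter_upwards [ae_restrict_mem hK.measurableSet] with x hx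
    rw [(hu.weak_grad j).hessian_mollify_indicator (hu.weak_hess i j) hK' hδΩ (hφδ k)
      (h_ball x hx), Pi.sub_apply]

variable {ν : Measure (EuclideanSpace ℝ (Fin N))} {w : ℕ → EuclideanSpace ℝ (Fin N) → ℝ}

theorem aestronglyMeasurable_hessian_apply {v : EuclideanSpace ℝ (Fin N) → ℝ} (hv : ContDiff ℝ 2 v)
    (i j : Fin N) : AEStronglyMeasurable (fun x => hessian v x i j) ν :=
  ((continuous_hessian hv).matrix_elem i j).aestronglyMeasurable

theorem aestronglyMeasurable_gradient_apply {v : EuclideanSpace ℝ (Fin N) → ℝ}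
    (hv : ContDiff ℝ 2 v) (i : Fin N) : AEStronglyMeasurable (fun x => ∇ v x i) ν := by
  have h_cont : Continuous (∇ v) := (contDiff_gradient (m := 1) hv le_rfl).continuous
  fun_prop

theorem ae_symm_of_tendsto_eLpNorm_hessian_sub (hp : p ≠ 0) (hw : ∀ k, ContDiff ℝ 2 (w k))
    (hD2u : ∀ i j, AEStronglyMeasurable (D2u i j) ν)
    (h : ∀ i j, Tendsto (fun k => eLpNorm (fun x => hessian (w k) x i j - D2u i j x) p ν) atTop
      (𝓝 0)) : ∀ᵐ x ∂ν, ∀ i j, D2u i j x = D2u j i x := by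
  simp only [ae_all_iff]
  refine fun i j => ae_eq_of_tendsto_eLpNorm_sub hp
    (fun k => aestronglyMeasurable_hessian_apply (hw k) i j) (hD2u i j) (hD2u j i) (h i j) ?_
  refine (h j i).congr fun k => ?_
  simp only [(isSymm_hessian (hw k) _).apply i j]
  rfl

/-- The error made in the inequality `Lu ≥ f` when the weak derivatives `Du` and `D2u` are replaced
by those of a smooth approximation `w`, for coefficients bounded by `Lam` and `c₁`. -/
noncomputable def approxError (Lam c₁ : ℝ) (Du : Fin N → EuclideanSpace ℝ (Fin N) → ℝ)
    (D2u : Fin N → Fin N → EuclideanSpace ℝ (Fin N) → ℝ) (w : EuclideanSpace ℝ (Fin N) → ℝ)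
    (x : EuclideanSpace ℝ (Fin N)) : ℝ :=
  Lam * ∑ i, ∑ j, |hessian w x i j - D2u i j x| + c₁ * ∑ i, |∇ w x i - Du i x|

theorem aestronglyMeasurable_approxError {v : EuclideanSpace ℝ (Fin N) → ℝ} (hv : ContDiff ℝ 2 v)
    (hDu : ∀ i, AEStronglyMeasurable (Du i) ν) (hD2u : ∀ i j, AEStronglyMeasurable (D2u i j) ν)
    (Lam c₁ : ℝ) : AEStronglyMeasurable (approxError Lam c₁ Du D2u v) ν := by
  refine .add (.const_mul (Finset.aestronglyMeasurable_fun_sum _ fun i _ =>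
    Finset.aestronglyMeasurable_fun_sum _ fun j _ => ?_) _)
    (.const_mul (Finset.aestronglyMeasurable_fun_sum _ fun i _ => ?_) _)
  · exact ((aestronglyMeasurable_hessian_apply hv i j).sub (hD2u i j)).norm
  · exact ((aestronglyMeasurable_gradient_apply hv i).sub (hDu i)).norm

theorem tendsto_eLpNorm_approxError (hp : 1 ≤ p) (hw : ∀ k, ContDiff ℝ 2 (w k))
    (hDu : ∀ i, AEStronglyMeasurable (Du i) ν) (hD2u : ∀ i j, AEStronglyMeasurable (D2u i j) ν)
    (h_grad : ∀ i, Tendsto (fun k => eLpNorm (fun x => ∇ (w k) x i - Du i x) p ν) atTop (𝓝 0))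
    (h_hess : ∀ i j, Tendsto (fun k => eLpNorm (fun x => hessian (w k) x i j - D2u i j x) p ν)
      atTop (𝓝 0)) (Lam c₁ : ℝ) :
    Tendsto (fun k => eLpNorm (approxError Lam c₁ Du D2u (w k)) p ν) atTop (𝓝 0) := by
  have h_grad_meas (k : ℕ) (i : Fin N) : AEStronglyMeasurable (fun x => |∇ (w k) x i - Du i x|) ν :=
    ((aestronglyMeasurable_gradient_apply (hw k) i).sub (hDu i)).norm
  have h_hess_meas (k : ℕ) (i j : Fin N) :
      AEStronglyMeasurable (fun x => |hessian (w k) x i j - D2u i j x|) ν :=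
    ((aestronglyMeasurable_hessian_apply (hw k) i j).sub (hD2u i j)).norm
  have h_split (k : ℕ) : approxError Lam c₁ Du D2u (w k)
      = Lam • (∑ i, ∑ j, fun x => |hessian (w k) x i j - D2u i j x|)
        + c₁ • ∑ i, fun x => |∇ (w k) x i - Du i x| := by
    ext x
    simp [approxError]
  have h_grad' (i : Fin N) :
      Tendsto (fun k => eLpNorm (fun x => |∇ (w k) x i - Du i x|) p ν) atTop (𝓝 0) := by
    simpa only [← Real.norm_eq_abs, eLpNorm_norm] using h_grad i
  have h_hess' (i j : Fin N) :
      Tendsto (fun k => eLpNorm (fun x => |hessian (w k) x i j - D2u i j x|) p ν) atTop (𝓝 0) := by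
    simpa only [← Real.norm_eq_abs, eLpNorm_norm] using h_hess i j
  have h_grad_sum :
      Tendsto (fun k => eLpNorm (∑ i, fun x => |∇ (w k) x i - Du i x|) p ν) atTop (𝓝 0) :=
    tendsto_eLpNorm_sum hp (fun k i _ => h_grad_meas k i) fun i _ => h_grad' i
  have h_row (k : ℕ) (i : Fin N) :
      AEStronglyMeasurable (∑ j, fun x => |hessian (w k) x i j - D2u i j x|) ν :=
    Finset.aestronglyMeasurable_sum _ fun j _ => h_hess_meas k i j
  have h_hess_sum : Tendsto (fun k => eLpNorm (∑ i, ∑ j, fun x => |hessian (w k) x i j - D2u i j x|)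
      p ν) atTop (𝓝 0) :=
    tendsto_eLpNorm_sum hp (fun k i _ => h_row k i) fun i _ =>
      tendsto_eLpNorm_sum hp (fun k j _ => h_hess_meas k i j) fun j _ => h_hess' i j
  have h_add :=
    (tendsto_eLpNorm_const_smul Lam h_hess_sum).add (tendsto_eLpNorm_const_smul c₁ h_grad_sum)
  rw [add_zero] at h_add
  simp only [h_split]
  refine tendsto_of_tendsto_of_tendsto_of_le_of_le tendsto_const_nhds h_add (fun _ => zero_le)
    fun k => eLpNorm_add_le
      (.const_smul (Finset.aestronglyMeasurable_sum _ fun i _ => h_row k i) _)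
      (.const_smul (Finset.aestronglyMeasurable_sum _ fun i _ => h_grad_meas k i) _) hp

theorem neg_sum_mul_hessian_le {a : Fin N → Fin N → ℝ} {b : Fin N → ℝ} {Lam c₁ f : ℝ}
    (ha : ∀ ξ : EuclideanSpace ℝ (Fin N), 0 ≤ ∑ i, ∑ j, a i j * ξ i * ξ j)
    (ha' : ∀ ξ : EuclideanSpace ℝ (Fin N), ∑ i, ∑ j, a i j * ξ i * ξ j ≤ Lam * ‖ξ‖ ^ 2)
    (hb : ∀ i, |b i| ≤ c₁) {v : EuclideanSpace ℝ (Fin N) → ℝ} (hv : ContDiff ℝ 2 v)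
    {x : EuclideanSpace ℝ (Fin N)} (hD2u : ∀ i j, D2u i j x = D2u j i x)
    (hf : f ≤ (∑ i, ∑ j, a i j * D2u i j x) + ∑ i, b i * Du i x) :
    -∑ i, ∑ j, a i j * hessian v x i j
      ≤ approxError Lam c₁ Du D2u v x - f + N * c₁ * ‖∇ v x‖ := by
  have h_hess : |∑ i, ∑ j, a i j * (hessian v x i j - D2u i j x)|
      ≤ Lam * ∑ i, ∑ j, |hessian v x i j - D2u i j x| :=
    abs_sum_mul_le_of_symm ha ha' fun i j => by rw [(isSymm_hessian hv x).apply i j, hD2u]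
  have h_mul (i : Fin N) (t : ℝ) : |b i * t| ≤ c₁ * |t| := by
    rw [abs_mul]
    exact mul_le_mul_of_nonneg_right (hb i) (abs_nonneg t)
  have h_grad : ∑ i, b i * (Du i x - ∇ v x i) ≤ c₁ * ∑ i, |∇ v x i - Du i x| := by
    rw [Finset.mul_sum]
    refine Finset.sum_le_sum fun i _ => ?_
    rw [abs_sub_comm]
    exact (le_abs_self _).trans (h_mul i _)
  have h_drift : ∑ i, b i * ∇ v x i ≤ N * c₁ * ‖∇ v x‖ := by
    calc ∑ i, b i * ∇ v x i ≤ ∑ _i : Fin N, c₁ * ‖∇ v x‖ := Finset.sum_le_sum fun i _ =>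
          (le_abs_self _).trans <| (h_mul i _).trans <|
            mul_le_mul_of_nonneg_left (by simpa using PiLp.norm_apply_le (∇ v x) i)
              ((abs_nonneg _).trans (hb i))
      _ = N * c₁ * ‖∇ v x‖ := by simp [mul_assoc]
  simp only [mul_sub, Finset.sum_sub_distrib] at h_hess h_grad
  rw [approxError]
  linarith [neg_le_of_abs_le h_hess]

end Approximation

section CompactEstimate

open Filter Topology
open scoped Gradient

/-- The factor `exp (C (1 + (N c₁) ^ N V) / lam ^ N)` of the Aleksandrov–Bakelman–Pucci estimate in
dimension `N`, on a set of measure `V`, for an operator with ellipticity constant `lam` and drift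
coefficients bounded by `c₁`. -/
noncomputable def abpFactor (N : ℕ) (lam c₁ V : ℝ) : ℝ :=
  Real.exp (abpConst N * (lam⁻¹ ^ N * (1 + (N * c₁) ^ N * V)))

variable {N : ℕ}

theorem abpFactor_pos (lam c₁ V : ℝ) : 0 < abpFactor N lam c₁ V := Real.exp_pos _

variable [NeZero N]

theorem abpFactor_mono {lam c₁ V V' : ℝ} (hlam : 0 < lam) (hc₁ : 0 ≤ c₁) (hV : V ≤ V') :
    abpFactor N lam c₁ V ≤ abpFactor N lam c₁ V' := by
  have := abpConst_pos (N := N)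
  unfold abpFactor
  gcongr

theorem eLpNorm_const_toReal_pow {α : Type*} [MeasurableSpace α] (μ : Measure α) {r : ℝ}
    (hr : 0 ≤ r) : (eLpNorm (fun _ : α => r) N μ).toReal ^ N = r ^ N * μ.real Set.univ := by
  rw [eLpNorm_const' r (NeZero.ne _) (ENNReal.natCast_ne_top N), ENNReal.toReal_mul, mul_pow,
    Real.enorm_of_nonneg hr, ENNReal.toReal_ofReal hr, ENNReal.toReal_natCast, ← ENNReal.toReal_pow,
    one_div, ENNReal.rpow_inv_natCast_pow (NeZero.ne N), Measure.real]

variable {K : Set (EuclideanSpace ℝ (Fin N))} {lam Lam c₁ m : ℝ}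
  {a : Fin N → Fin N → EuclideanSpace ℝ (Fin N) → ℝ} {b : Fin N → EuclideanSpace ℝ (Fin N) → ℝ}
  {f u v : EuclideanSpace ℝ (Fin N) → ℝ} {Du : Fin N → EuclideanSpace ℝ (Fin N) → ℝ}
  {D2u : Fin N → Fin N → EuclideanSpace ℝ (Fin N) → ℝ} {x₀ : EuclideanSpace ℝ (Fin N)}

theorem le_add_of_contDiff_of_approxError (hK : IsCompact K) (hlam : 0 < lam) (hc₁ : 0 ≤ c₁)
    (ha : ∀ᵐ x ∂volume.restrict K, ∀ ξ : EuclideanSpace ℝ (Fin N),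
      lam * ‖ξ‖ ^ 2 ≤ ∑ i, ∑ j, a i j x * ξ i * ξ j)
    (ha' : ∀ᵐ x ∂volume.restrict K, ∀ ξ : EuclideanSpace ℝ (Fin N),
      ∑ i, ∑ j, a i j x * ξ i * ξ j ≤ Lam * ‖ξ‖ ^ 2)
    (hb : ∀ᵐ x ∂volume.restrict K, ∀ i, |b i x| ≤ c₁) (hf : MemLp f N (volume.restrict K))
    (hD2u : ∀ᵐ x ∂volume.restrict K, ∀ i j, D2u i j x = D2u j i x)
    (hv : ContDiff ℝ 2 v) (hvm : ∀ x ∈ frontier K, v x ≤ m)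
    (hfv : ∀ᵐ x ∂volume.restrict K, m < v x →
      f x ≤ (∑ i, ∑ j, a i j x * D2u i j x) + ∑ i, b i x * Du i x)
    (hE : MemLp (approxError Lam c₁ Du D2u v) N (volume.restrict K)) (hx₀ : x₀ ∈ K) :
    v x₀ ≤ m + abpFactor N lam c₁ (volume.real K) * Metric.diam K *
      (eLpNorm (approxError Lam c₁ Du D2u v) N (volume.restrict K)
        + eLpNorm f N (volume.restrict K)).toReal := by
  have : IsFiniteMeasure (volume.restrict K) := isFiniteMeasure_restrict.mpr hK.measure_ne_top
  have hN : (1 : ℝ≥0∞) ≤ N := Nat.one_le_cast.mpr (NeZero.one_le)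
  have h_abp := abp_estimate_of_contDiff (h := approxError Lam c₁ Du D2u v - f)
    (β := fun _ => N * c₁) hK hv hvm hlam ha (hE.sub hf) (memLp_const _) ?_ hx₀
  · rw [eLpNorm_const_toReal_pow _ (by positivity), measureReal_restrict_apply_univ] at h_abp
    refine h_abp.trans (add_le_add_right (mul_le_mul_of_nonneg_left ?_ ?_) m)
    · exact ENNReal.toReal_mono (ENNReal.add_ne_top.mpr ⟨hE.eLpNorm_ne_top, hf.eLpNorm_ne_top⟩)
        (eLpNorm_sub_le hE.1 hf.1 hN)
    · positivity
  · filter_upwards [ha, ha', hb, hD2u, hfv] with x hax hax' hbx hsymm hfx hmx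
    exact neg_sum_mul_hessian_le (fun ξ => (by positivity : (0 : ℝ) ≤ _).trans (hax ξ)) hax' hbx hv
      hsymm (hfx hmx)

theorem IsW2Loc.le_add_of_isCompact {Ω : Set (EuclideanSpace ℝ (Fin N))}
    (hu : IsW2Loc N Ω u Du D2u) (huc : ContinuousOn u Ω) (hΩ : IsOpen Ω) (hK : IsCompact K)
    (hKΩ : K ⊆ Ω) (hlam : 0 < lam) (hc₁ : 0 ≤ c₁)
    (ha : ∀ᵐ x ∂volume.restrict K, ∀ ξ : EuclideanSpace ℝ (Fin N),
      lam * ‖ξ‖ ^ 2 ≤ ∑ i, ∑ j, a i j x * ξ i * ξ j)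
    (ha' : ∀ᵐ x ∂volume.restrict K, ∀ ξ : EuclideanSpace ℝ (Fin N),
      ∑ i, ∑ j, a i j x * ξ i * ξ j ≤ Lam * ‖ξ‖ ^ 2)
    (hb : ∀ᵐ x ∂volume.restrict K, ∀ i, |b i x| ≤ c₁) (hf : MemLp f N (volume.restrict K))
    (hum : ∀ x ∈ frontier K, u x ≤ m)
    (hfu : ∀ᵐ x ∂volume.restrict K, m < u x →
      f x ≤ (∑ i, ∑ j, a i j x * D2u i j x) + ∑ i, b i x * Du i x) (hx₀ : x₀ ∈ K) :
    u x₀ ≤ m + abpFactor N lam c₁ (volume.real K) * Metric.diam K *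
      (eLpNorm f N (volume.restrict K)).toReal := by
  set M := abpFactor N lam c₁ (volume.real K) * Metric.diam K
  have hN : (1 : ℝ≥0∞) ≤ N := Nat.one_le_cast.mpr (NeZero.one_le)
  obtain ⟨w, hw, hwu, h_grad, h_hess⟩ :=
    hu.exists_seq_contDiff_tendsto hN (ENNReal.natCast_ne_top N) huc hΩ hK hKΩ
  have hDu (i : Fin N) := (hu.memLp_grad i K hK hKΩ).1
  have hD2u (i j : Fin N) := (hu.memLp_hess i j K hK hKΩ).1
  have h_symm := ae_symm_of_tendsto_eLpNorm_hessian_sub (NeZero.ne _) hw hD2u h_hess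
  have h_err := tendsto_eLpNorm_approxError hN hw hDu hD2u h_grad h_hess Lam c₁
  have h_bound (ε : ℝ) (hε : 0 < ε) :
      u x₀ - (m + 2 * ε) ≤ M * (eLpNorm f N (volume.restrict K)).toReal := by
    have h_lim : Tendsto (fun k => M * (eLpNorm (approxError Lam c₁ Du D2u (w k)) N
        (volume.restrict K) + eLpNorm f N (volume.restrict K)).toReal) atTop
        (𝓝 (M * (eLpNorm f N (volume.restrict K)).toReal)) := by
      have h_add := h_err.add_const (eLpNorm f N (volume.restrict K))
      rw [zero_add] at h_add
      exact ((ENNReal.tendsto_toReal hf.eLpNorm_ne_top).comp h_add).const_mul M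
    refine ge_of_tendsto h_lim ?_
    filter_upwards [h_err.eventually_lt_const ENNReal.zero_lt_top,
      Metric.tendstoUniformlyOn_iff.mp hwu ε hε] with k hk h_close
    have h_abs (x) (hx : x ∈ K) := abs_lt.mp (Real.dist_eq _ _ ▸ h_close x hx)
    have h_abp := le_add_of_contDiff_of_approxError (m := m + ε) hK hlam hc₁ ha ha' hb hf h_symm
      (hw k) (fun x hx => by linarith [hum x hx, h_abs x (hK.isClosed.frontier_subset hx)]) ?_
      ⟨aestronglyMeasurable_approxError (hw k) hDu hD2u Lam c₁, hk⟩ hx₀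
    · linarith [h_abs x₀ hx₀]
    · filter_upwards [hfu, ae_restrict_mem hK.measurableSet] with x hfx hx hmx
      exact hfx (by linarith [h_abs x hx])
  refine le_of_forall_pos_le_add fun ε hε => ?_
  linarith [h_bound (ε / 2) (half_pos hε)]

end CompactEstimate

section Exhaustion

theorem exists_isCompact_forall_frontier_lt {X β : Type*} [TopologicalSpace X] [T2Space X]
    [LocallyCompactSpace X] [LinearOrder β] [TopologicalSpace β] [OrderClosedTopology β]
    {Ω : Set X} (hΩ : IsOpen Ω) (hΩc : IsCompact (closure Ω)) {u : X → β}
    (hu : ContinuousOn u (closure Ω)) {m : β} (hum : ∀ x ∈ frontier Ω, u x < m) {x : X}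
    (hx : x ∈ Ω) : ∃ K, IsCompact K ∧ K ⊆ Ω ∧ x ∈ K ∧ ∀ y ∈ frontier K, u y < m := by
  have h_superlevel : IsCompact (closure Ω ∩ u ⁻¹' Set.Ici m) :=
    hΩc.of_isClosed_subset (hu.preimage_isClosed_of_isClosed isClosed_closure isClosed_Ici)
      Set.inter_subset_left
  have h_subset : insert x (closure Ω ∩ u ⁻¹' Set.Ici m) ⊆ Ω := by
    refine Set.insert_subset hx fun y hy => ?_
    by_contra hyΩ
    exact (hum y ⟨hy.1, fun h => hyΩ (interior_subset h)⟩).not_ge hy.2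
  obtain ⟨K, hK, h_int, hKΩ⟩ := exists_compact_between (h_superlevel.insert x) hΩ h_subset
  refine ⟨K, hK, hKΩ, interior_subset (h_int (Set.mem_insert x _)), fun y hy => ?_⟩
  by_contra! h
  have hyΩ : y ∈ Ω := hKΩ (hK.isClosed.frontier_subset hy)
  exact hy.2 (h_int (Set.mem_insert_of_mem x ⟨subset_closure hyΩ, h⟩))

end Exhaustion

section Exponent

theorem coeffSize_bounds {lam : ℝ} (hlam : 0 < lam) (Lam c₁ c₂ : ℝ) :
    lam⁻¹ ≤ coeffSize lam Lam c₁ c₂ ∧ c₁ ≤ coeffSize lam Lam c₁ c₂ ∧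
      1 ≤ coeffSize lam Lam c₁ c₂ := by
  have h_lam : lam ≤ coeffSize lam Lam c₁ c₂ := by simp [coeffSize]
  have h_inv : lam⁻¹ ≤ coeffSize lam Lam c₁ c₂ := by simp [coeffSize]
  refine ⟨h_inv, by simp [coeffSize], ?_⟩
  rcases le_total 1 lam with h | h
  · exact h.trans h_lam
  · exact ((one_le_inv₀ hlam).mpr h).trans h_inv

theorem abpFactor_le_exp {N : ℕ} [NeZero N] {lam c₁ S V : ℝ} (hlam : 0 < lam) (hc₁ : 0 ≤ c₁)
    (hV : 0 ≤ V) (hlamS : lam⁻¹ ≤ S) (hc₁S : c₁ ≤ S) (hS : 1 ≤ S) :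
    abpFactor N lam c₁ V ≤ Real.exp (abpConst N * N ^ N * (1 + V) * S ^ (2 * N)) := by
  have hC := abpConst_pos (N := N)
  have hN : (1 : ℝ) ≤ N ^ N := one_le_pow₀ (Nat.one_le_cast.mpr NeZero.one_le)
  have hSN : 1 ≤ S ^ N := one_le_pow₀ hS
  refine Real.exp_le_exp.mpr ?_
  calc abpConst N * (lam⁻¹ ^ N * (1 + (N * c₁) ^ N * V))
      ≤ abpConst N * (S ^ N * (N ^ N * S ^ N + (N * S) ^ N * V)) := by
        gcongr
        exact one_le_mul_of_one_le_of_one_le hN hSN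
    _ = abpConst N * N ^ N * (1 + V) * S ^ (2 * N) := by ring

end Exponent

end ABP

theorem theoremC1_general {N : ℕ} [NeZero N] {Ω : Set (EuclideanSpace ℝ (Fin N))} (hΩ : IsOpen Ω)
    (hΩb : Bornology.IsBounded Ω) {lam Lam c₁ m : ℝ} (hlam : 0 < lam) (hc₁ : 0 ≤ c₁) (hm : 0 ≤ m)
    {a : Fin N → Fin N → EuclideanSpace ℝ (Fin N) → ℝ} {b : Fin N → EuclideanSpace ℝ (Fin N) → ℝ}
    {c : EuclideanSpace ℝ (Fin N) → ℝ}
    (ha : ∀ᵐ x ∂volume.restrict Ω, ∀ ξ : EuclideanSpace ℝ (Fin N),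
      lam * ‖ξ‖ ^ 2 ≤ ∑ i, ∑ j, a i j x * ξ i * ξ j)
    (ha' : ∀ᵐ x ∂volume.restrict Ω, ∀ ξ : EuclideanSpace ℝ (Fin N),
      ∑ i, ∑ j, a i j x * ξ i * ξ j ≤ Lam * ‖ξ‖ ^ 2)
    (hb : ∀ᵐ x ∂volume.restrict Ω, ∀ i, |b i x| ≤ c₁) (hc : ∀ᵐ x ∂volume.restrict Ω, c x ≤ 0)
    {f u : EuclideanSpace ℝ (Fin N) → ℝ} {Du : Fin N → EuclideanSpace ℝ (Fin N) → ℝ}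
    {D2u : Fin N → Fin N → EuclideanSpace ℝ (Fin N) → ℝ} (hf : MemLp f N (volume.restrict Ω))
    (hu : ContinuousOn u (closure Ω)) (hum : ∀ x ∈ frontier Ω, u x ≤ m)
    (huW : ABP.IsW2Loc N Ω u Du D2u)
    (hLu : ∀ᵐ x ∂volume.restrict Ω, f x ≤ ABP.ellipticOp a b c u Du D2u x)
    {x : EuclideanSpace ℝ (Fin N)} (hx : x ∈ Ω) :
    u x ≤ m + ABP.abpFactor N lam c₁ (volume.real Ω) * Metric.diam Ω *
      (eLpNorm f N (volume.restrict Ω)).toReal := by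
  have h_bound (ε : ℝ) (hε : 0 < ε) : u x ≤ m + ε + ABP.abpFactor N lam c₁ (volume.real Ω) *
      Metric.diam Ω * (eLpNorm f N (volume.restrict Ω)).toReal := by
    obtain ⟨K, hK, hKΩ, hxK, hK_frontier⟩ := ABP.exists_isCompact_forall_frontier_lt hΩ
      hΩb.isCompact_closure hu (m := m + ε) (fun y hy => by linarith [hum y hy]) hx
    have h_le : volume.restrict K ≤ volume.restrict Ω := Measure.restrict_mono_set _ hKΩ
    have h_ac := h_le.absolutelyContinuous
    have h_abp := huW.le_add_of_isCompact (hu.mono subset_closure) hΩ hK hKΩ hlam hc₁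
      (h_ac.ae_le ha) (h_ac.ae_le ha') (h_ac.ae_le hb) (hf.mono_measure h_le)
      (fun y hy => (hK_frontier y hy).le) ?_ hxK
    · refine h_abp.trans ?_
      have hV : volume.real K ≤ volume.real Ω := measureReal_mono hKΩ hΩb.measure_lt_top.ne
      have := (ABP.abpFactor_pos (N := N) lam c₁ (volume.real Ω)).le
      gcongr
      · exact ABP.abpFactor_mono hlam hc₁ hV
      · exact Metric.diam_mono hKΩ hΩb
      · exact hf.eLpNorm_ne_top
    · filter_upwards [h_ac.ae_le hc, h_ac.ae_le hLu] with y hcy hLy hmy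
      have h_zero : c y * u y ≤ 0 := mul_nonpos_of_nonpos_of_nonneg hcy (by linarith)
      rw [ABP.ellipticOp] at hLy
      linarith
  refine le_of_forall_pos_le_add fun ε hε => ?_
  linarith [h_bound ε hε]

theorem theoremC1 (n : ℕ) :
    ∃ (C : ℝ) (m : ℕ), 0 < C ∧
      ∀ (Ω : Set (EuclideanSpace ℝ (Fin (n + 1)))),
        IsOpen Ω → Bornology.IsBounded Ω →
      ∀ (lam Lam c₁ c₂ : ℝ), 0 < lam → 0 < Lam → 0 < c₁ → 0 < c₂ →
      ∀ (a : Fin (n + 1) → Fin (n + 1) → EuclideanSpace ℝ (Fin (n + 1)) → ℝ)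
        (b : Fin (n + 1) → EuclideanSpace ℝ (Fin (n + 1)) → ℝ)
        (c : EuclideanSpace ℝ (Fin (n + 1)) → ℝ),
        ABP.CoeffBounds Ω a b c lam Lam c₁ c₂ →
      ∀ (f : EuclideanSpace ℝ (Fin (n + 1)) → ℝ),
        MemLp f ((n + 1 : ℕ) : ℝ≥0∞) (volume.restrict Ω) →
      ∀ (u : EuclideanSpace ℝ (Fin (n + 1)) → ℝ)
        (Du : Fin (n + 1) → EuclideanSpace ℝ (Fin (n + 1)) → ℝ)
        (D2u : Fin (n + 1) → Fin (n + 1) → EuclideanSpace ℝ (Fin (n + 1)) → ℝ),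
        ABP.IsC00 Ω u →
        ABP.IsW2Loc ((n + 1 : ℕ) : ℝ≥0∞) Ω u Du D2u →
        (∀ᵐ x ∂(volume.restrict Ω), f x ≤ ABP.ellipticOp a b c u Du D2u x) →
      ∀ x ∈ Ω,
        u x ≤ Real.exp (C * (1 + (volume Ω).toReal) * ABP.coeffSize lam Lam c₁ c₂ ^ m)
          * Metric.diam Ω
          * (eLpNorm f ((n + 1 : ℕ) : ℝ≥0∞) (volume.restrict Ω)).toReal := by
  have hC := ABP.abpConst_pos (N := n + 1)
  refine ⟨ABP.abpConst (n + 1) * (n + 1 : ℕ) ^ (n + 1), 2 * (n + 1), by positivity, ?_⟩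
  intro Ω hΩ hΩb lam Lam c₁ c₂ hlam _ hc₁ _ a b c hco f hf u Du D2u hu0 hu hLu x hx
  obtain ⟨h_inv, h_drift, h_one⟩ := ABP.coeffSize_bounds hlam Lam c₁ c₂
  have h_abp := theoremC1_general hΩ hΩb hlam hc₁.le le_rfl hco.lower hco.upper hco.bound_b
    hco.nonpos_c hf hu0.continuousOn (fun y hy => (hu0.eq_zero y hy).le) hu hLu hx
  rw [zero_add] at h_abp
  refine h_abp.trans ?_
  gcongr
  exact ABP.abpFactor_le_exp hlam hc₁.le measureReal_nonneg h_inv h_drift h_one
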